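/- **Setting.** Write $\log=\log_{4/3}$ and $[\ln\ln]_+(x)=\ln\ln\max\{x,e^e\}$. A labeler answers a query $x\in[0,1]$ with a response in $\{0,1,\perp\}$ ($\perp$: abstention) drawn from a distribution $P(\cdot\mid x)$, independently of everything else. Let $\theta^*\in[0,1]$ be the ground truth threshold and assume * (abstention) for all $x,x'\in[0,1]$ with $|x-\theta^*|\ge|x'-\theta^*|$: $P(\perp\mid x)\le P(\perp\mid x')$; * (noise) for all $x\in[0,1]$ with $P(Y\ne\perp\mid x)>0$: $P(Y\ne\mathbf 1[x>\theta^*]\mid x,\,Y\ne\perp)\le\frac12$. **Constants.** For a real array $X_1,\dots,X_n$ let $V_n=\frac{n}{n-1}\bigl(\sum_i X_i^2-\frac1n(\sum_i X_i)^2\bigr)$ ($n\ge2$), and let $$p(n,\delta)=D_0\Bigl(1+\ln\tfrac1\delta+\sqrt{4n([\ln\ln]_+(4n)+\ln\tfrac1\delta)}\Bigr),\qquad q(v,\delta)=D_1\Bigl(1+\ln\tfrac1\delta+\sqrt{(v+\ln\tfrac1\delta+1)([\ln\ln]_+(v+\ln\tfrac1\delta+1)+\ln\tfrac1\delta)}\Bigr).$$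 Call $D_0>0$ (respectively $D_1>0$) admissible if for every i.i.d. sequence $X_1,X_2,\dots$ with values in $[-2,2]$ and mean $0$, and every $0<\delta<1$, with probability at least $1-\delta$ one has $|\sum_{i\le n}X_i|\le p(n,\delta)$ for all $n\ge1$ (respectively $|\sum_{i\le n}X_i|\le q(V_n,\delta)$ for all $n\ge2$ with $n\ge\ln\frac1\delta$). **Tests.** For an array $X=(X_1,\dots,X_n)$, $\mathrm{CS}(X,\eta)$ holds if $\sum_iX_i\ge p(n,\eta)$; $\mathrm{CSV}(X,\eta)$ holds if $n\ge\ln\frac1\eta$ and $\sum_iX_i\ge q(V_n,\eta)$. **Algorithm.** The input is $\delta\in(0,1)$ and $\epsilon>0$ such that $K=\log\frac1{2\epsilon}$ is a nonnegative integer. Put $\eta=\delta/(4K)$ and $[L_0,R_0]=[0,1]$. For $k=0,\dots,K-1$ put $U=\frac{3L_k+R_k}4$, $M=\frac{L_k+R_k}2$, $V=\frac{L_k+3R_k}4$, start with empty arrays, and for $n=1,2,\dots$: query the labeler at $U,M,V$; for each $w\in\{u,m,v\}$ (corresponding to $U,M,V$) append to the array $A^{(w)}$ the entry $1$ if a label was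 received and $0$ if the labeler abstained; if a label was received, append it to $B^{(w)}$, coded as $+1$ for label $1$ and $-1$ for label $0$. Then go through the following tests in this order, and at the first one that holds set the next interval and leave the inner loop (if none holds, continue with $n+1$): 1. $\mathrm{CSV}(A^{(u)}-A^{(m)},\eta)$: $[L_{k+1},R_{k+1}]=[U,R_k]$; 2. $\mathrm{CSV}(A^{(v)}-A^{(m)},\eta)$: $[L_{k+1},R_{k+1}]=[L_k,V]$; 3. $\mathrm{CS}(-B^{(u)},\eta)$: $[L_{k+1},R_{k+1}]=[U,R_k]$; 4. $\mathrm{CS}(B^{(v)},\eta)$: $[L_{k+1},R_{k+1}]=[L_k,V]$. If all $K$ inner loops end, stop and output $\hat\theta=(L_K+R_K)/2$. **Theorem.** Admissible absolute constants $D_0$ and $D_1$ exist. For all admissible $D_0,D_1$, all $\theta^*$ and $P$ as above, and all inputs $\delta,\epsilon$ as above, with probability at least $1-\frac\delta2$ over the responses of the labeler the following holds: if the algorithm stops, then its output satisfies $|\hat\theta-\theta^*|\le\epsilon$. -/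

import Mathlib

open MeasureTheory ProbabilityTheory

namespace ThresholdLearning

/-- The response of the labeler to one query: label `0`, label `1`, or abstention. -/
inductive Response : Type
  | zero
  | one
  | abstain
  deriving DecidableEq

instance : MeasurableSpace Response := ⊤

instance : DiscreteMeasurableSpace Response := ⟨fun _ => trivial⟩

open Classical in
/-- The ground truth label `𝟙[x > θ]`. -/
noncomputable def trueLabel (θ x : ℝ) : Response :=
  if θ < x then Response.one else Response.zero

/-- The condition on the response distributions `P x = P(Y = · | X = x)`, `x ∈ [0,1]`, with respect
to the ground truth threshold `θ`. When the labeler abstains at `x` almost surely, the conditional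
measure in `noise` is the zero measure, so that nothing is required there. -/
structure LabelerCondition (P : ℝ → PMF Response) (θ : ℝ) : Prop where
  abstention : ∀ x ∈ Set.Icc (0 : ℝ) 1, ∀ x' ∈ Set.Icc (0 : ℝ) 1, |x' - θ| ≤ |x - θ| →
    P x Response.abstain ≤ P x' Response.abstain
  noise : ∀ x ∈ Set.Icc (0 : ℝ) 1,
    ((P x).toMeasure[|{y | y ≠ Response.abstain}]) {y | y ≠ trueLabel θ x} ≤ 1 / 2

/-! ### The two sequential tests -/

/-- `[ln ln]₊(x) = ln ln max{x, e^e}`. -/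
noncomputable def lnlnPlus (x : ℝ) : ℝ :=
  Real.log (Real.log (max x (Real.exp (Real.exp 1))))

/-- The threshold `p(n, δ)`, with constant `D₀`. -/
noncomputable def pThreshold (D₀ : ℝ) (n : ℕ) (δ : ℝ) : ℝ :=
  D₀ * (1 + Real.log (1 / δ) + √(4 * n * (lnlnPlus (4 * n) + Real.log (1 / δ))))

/-- The threshold `q(n, Var, δ)`, with constant `D₁` (it does not depend on `n`). -/
noncomputable def qThreshold (D₁ var δ : ℝ) : ℝ :=
  D₁ * (1 + Real.log (1 / δ) +
    √((var + Real.log (1 / δ) + 1) *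
      (lnlnPlus (var + Real.log (1 / δ) + 1) + Real.log (1 / δ))))

/-- The empirical variance `n/(n-1) * (∑ Xᵢ² - (∑ Xᵢ)²/n)` of an array of length `n`. -/
noncomputable def empVar (X : List ℝ) : ℝ :=
  (X.length : ℝ) / ((X.length : ℝ) - 1) *
    ((X.map (fun x => x ^ 2)).sum - 1 / (X.length : ℝ) * X.sum ^ 2)

/-- The test `CheckSignificant`, with constant `D₀`. -/
def CheckSignificant (D₀ : ℝ) (X : List ℝ) (δ : ℝ) : Prop :=
  pThreshold D₀ X.length δ ≤ X.sum

/-- The test `CheckSignificant-Var`, with constant `D₁`. -/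
def CheckSignificantVar (D₁ : ℝ) (X : List ℝ) (δ : ℝ) : Prop :=
  Real.log (1 / δ) ≤ X.length ∧ qThreshold D₁ (empVar X) δ ≤ X.sum

/-! ### Admissible values of the absolute constants `D₀` and `D₁`

Here `ν` is the common law of a sequence of i.i.d. centred random variables with values
in `[-2,2]`, and the sequence is realised as the coordinate process of the product measure. -/

/-- `D₀` is an admissible constant of the uniform concentration inequality for i.i.d. sums. -/
def IsMeanConstant (D₀ : ℝ) : Prop :=
  0 < D₀ ∧ ∀ (ν : Measure ℝ) [IsProbabilityMeasure ν],
    (∀ᵐ x ∂ν, x ∈ Set.Icc (-2 : ℝ) 2) → ∫ x, x ∂ν = 0 →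
    ∀ δ : ℝ, 0 < δ → δ < 1 →
      1 - δ ≤ (Measure.infinitePi (fun _ : ℕ => ν)).real
        {X : ℕ → ℝ | ∀ n : ℕ, 0 < n →
          |((List.range n).map X).sum| ≤ pThreshold D₀ n δ}

/-- `D₁` is an admissible constant of the uniform concentration inequality for i.i.d. sums in terms
of the empirical variance (which is defined for arrays of length `n ≥ 2`). -/
def IsVarConstant (D₁ : ℝ) : Prop :=
  0 < D₁ ∧ ∀ (ν : Measure ℝ) [IsProbabilityMeasure ν],
    (∀ᵐ x ∂ν, x ∈ Set.Icc (-2 : ℝ) 2) → ∫ x, x ∂ν = 0 →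
    ∀ δ : ℝ, 0 < δ → δ < 1 →
      1 - δ ≤ (Measure.infinitePi (fun _ : ℕ => ν)).real
        {X : ℕ → ℝ | ∀ n : ℕ, 2 ≤ n → Real.log (1 / δ) ≤ n →
          |((List.range n).map X).sum| ≤ qThreshold D₁ (empVar ((List.range n).map X)) δ}

/-! ### The algorithm -/

/-- The array `A`: entry `1` for a label, entry `0` for an abstention. -/
def arrayA (X : List Response) : List ℝ :=
  X.map (fun y => match y with
    | Response.abstain => 0
    | Response.zero => 1
    | Response.one => 1)

/-- The array `B`: the labels received, `0` written as `-1` and `1` as `1`, abstentions skipped. -/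
def arrayB (X : List Response) : List ℝ :=
  X.filterMap (fun y => match y with
    | Response.abstain => none
    | Response.zero => some (-1)
    | Response.one => some 1)

/-- The quartile `U` of the interval `I = (L, R)`. -/
noncomputable def ptU (I : ℝ × ℝ) : ℝ := (3 * I.1 + I.2) / 4

/-- The midpoint `M` of the interval `I = (L, R)`. -/
noncomputable def ptM (I : ℝ × ℝ) : ℝ := (I.1 + I.2) / 2

/-- The quartile `V` of the interval `I = (L, R)`. -/
noncomputable def ptV (I : ℝ × ℝ) : ℝ := (I.1 + 3 * I.2) / 4

open Classical in
/-- The four tests, at confidence level `η`, that end one iteration of the inner loop on the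
interval `I`, after the responses `Xu`, `Xm`, `Xv` at the points `U`, `M`, `V`. The value is the
next interval, or `none` if the inner loop continues. -/
noncomputable def tests (D₀ D₁ η : ℝ) (I : ℝ × ℝ) (Xu Xm Xv : List Response) : Option (ℝ × ℝ) :=
  if CheckSignificantVar D₁ (List.zipWith (fun a b => a - b) (arrayA Xu) (arrayA Xm)) η then
    some (ptU I, I.2)
  else if CheckSignificantVar D₁ (List.zipWith (fun a b => a - b) (arrayA Xv) (arrayA Xm)) η then
    some (I.1, ptV I)
  else if CheckSignificant D₀ ((arrayB Xu).map (fun b => -b)) η then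
    some (ptU I, I.2)
  else if CheckSignificant D₀ (arrayB Xv) η then
    some (I.1, ptV I)
  else
    none

/-- The result of the tests in the `n`-th iteration, `n = 1, 2, …`, of the inner loop on the
interval `I`, where `y i x` is the response to the query at `x` in the `(i+1)`-th iteration. -/
noncomputable def iterationResult (D₀ D₁ η : ℝ) (y : ℕ → ℝ → Response) (I : ℝ × ℝ) (n : ℕ) :
    Option (ℝ × ℝ) :=
  tests D₀ D₁ η I ((List.range n).map (fun i => y i (ptU I)))
    ((List.range n).map (fun i => y i (ptM I))) ((List.range n).map (fun i => y i (ptV I)))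

open Classical in
/-- The inner loop `n = 1, 2, …` on the interval `I`: the result of the first iteration in which a
test succeeds, or `none` if the loop runs forever. -/
noncomputable def innerLoop (D₀ D₁ η : ℝ) (y : ℕ → ℝ → Response) (I : ℝ × ℝ) : Option (ℝ × ℝ) :=
  if h : ∃ n : ℕ, 1 ≤ n ∧ iterationResult D₀ D₁ η y I n ≠ none then
    iterationResult D₀ D₁ η y I (Nat.find h)
  else
    none

/-- The interval `[L_k, R_k]` (as a pair) with confidence level `η` in every test, or `none` if the
outer loop never reaches the index `k`. Here `y k i x` is the response to the query at `x` in the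
`(i+1)`-th iteration of the inner loop within the `k`-th pass of the outer loop. -/
noncomputable def interval (D₀ D₁ η : ℝ) (y : ℕ → ℕ → ℝ → Response) : ℕ → Option (ℝ × ℝ)
  | 0 => some (0, 1)
  | k + 1 => (interval D₀ D₁ η y k).bind (innerLoop D₀ D₁ η (y k))

/-- `log (1/(2ε))`, to base `4/3`. -/
noncomputable def logInv (ε : ℝ) : ℝ := Real.logb (4 / 3) (1 / (2 * ε))

/-- The output of the algorithm with input `δ`, `ε`, for `logInv ε` a natural number;
`none` if the algorithm does not stop. -/
noncomputable def output (D₀ D₁ δ ε : ℝ) (y : ℕ → ℕ → ℝ → Response) : Option ℝ :=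
  (interval D₀ D₁ (δ / (4 * logInv ε)) y ⌊logInv ε⌋₊).map (fun I => (I.1 + I.2) / 2)

/-- `Y k i x` is the random response of the labeler to the query at `x` in the `(i+1)`-th iteration
of the inner loop within the `k`-th pass of the outer loop, drawn from `P x` independently of all
others. An execution of the algorithm only reads the responses to the queries it makes. -/
structure IsResponseFamily {Ω : Type*} [MeasurableSpace Ω] (μ : Measure Ω) (P : ℝ → PMF Response)
    (Y : ℕ → ℕ → ℝ → Ω → Response) : Prop where
  measurable : ∀ k i x, Measurable (Y k i x)
  law : ∀ k i x, μ.map (Y k i x) = (P x).toMeasure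
  indep : iIndepFun (fun j : ℕ × ℕ × ℝ => Y j.1 j.2.1 j.2.2) μ

end ThresholdLearning

/-!
The interval `[L_k, R_k]` can only lose the threshold `θ` in a pass in which `θ < U` and one of the
two tests that move to `[U, R_k]` succeeds, or in which `V < θ` and one of the two tests that move
to `[L_k, V]` succeeds. In either case both tests add up i.i.d. numbers in `[-1,1]` of nonpositive
mean: at the quartile that separates `θ` from the midpoint `M`, abstention is at least as likely as
at `M`, and the label tested for is at most as likely as the other one. Subtracting the mean leads
to centred variables in `[-2,2]`, for which `p` and `q` bound all partial sums with probability
`1 - η`, so that each pass fails with probability at most `2 η`, and the `K` passes together with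
probability at most `2 η K = δ / 2`. If no pass fails, then `θ` lies in the last interval, of length
`(3/4) ^ K = 2 ε`, and its midpoint is `ε`-close to `θ`. Three points need care.

* The tests are non-strict, as are the inequalities in the definition of admissible constants. As
  the thresholds are strictly decreasing in the confidence level, the level `η` is approached from
  above (`measure_exists_pThreshold_le`, `measure_exists_qThreshold_le`).
* The number of labels after `n` queries is random. The responses have the law of a sequence of
  labels thinned by an independent sequence of decisions to answer; given the latter, the labels
  received are i.i.d. (`measure_exists_thinned_le`, `measure_exists_checkSignificant_label_le`).
* The points queried in a pass depend on the earlier responses, but the interval takes only finitely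
  many values and is independent of the responses in the pass
  (`measure_interval_inter_passFailure`).

Admissible constants exist by a self-normalised law of the iterated logarithm at finite times. As
`exp (x - x ^ 2) ≤ 1 + x` for `|x| ≤ 1/2`, the process `exp (λ S_n - λ ^ 2 Q_n)`, with `S_n` the sum
and `Q_n` the sum of squares, is a supermartingale for `|λ| ≤ 1/4`, and Ville's inequality
(`mul_measure_exists_le_prod`) bounds `|S_n|` for all `n` at once by an affine function of `Q_n`.
A union bound over a geometric grid of slopes `λ` and the lower envelope of these bounds
(`le_of_forall_gridSlope`) give a bound of the order of `√(Q_n ln ln Q_n)`. In it `Q_n` may be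
replaced by `4 n` (`le_of_le_sqrt_of_le_card`), and also by the empirical variance
(`exists_forall_le_of_le_add`), which `Q_n` exceeds by at most `2 |S_n|` (`sum_sq_le_empVar_add`).
-/

namespace ThresholdLearning

/-! ### The iterated logarithm and the envelope of the linear bounds -/

lemma exp_one_le_log_max (x : ℝ) : Real.exp 1 ≤ Real.log (max x (Real.exp (Real.exp 1))) := by
  have h : Real.exp (Real.exp 1) ≤ max x (Real.exp (Real.exp 1)) := le_max_right _ _
  rwa [Real.le_log_iff_exp_le (lt_of_lt_of_le (Real.exp_pos _) h)]

lemma one_le_lnlnPlus (x : ℝ) : 1 ≤ lnlnPlus x := by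
  have h := exp_one_le_log_max x
  rwa [lnlnPlus, Real.le_log_iff_exp_le (lt_of_lt_of_le (Real.exp_pos _) h)]

lemma two_le_log_max (x : ℝ) : 2 ≤ Real.log (max x (Real.exp (Real.exp 1))) := by
  have h := exp_one_le_log_max x
  have := Real.add_one_le_exp (1 : ℝ)
  linarith

lemma lnlnPlus_mono {x y : ℝ} (h : x ≤ y) : lnlnPlus x ≤ lnlnPlus y := by
  have h2 := two_le_log_max x
  have h0 : 0 < max x (Real.exp (Real.exp 1)) := lt_max_of_lt_right (Real.exp_pos _)
  exact Real.log_le_log (by linarith) (Real.log_le_log h0 (max_le_max_right _ h))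

lemma lnlnPlus_mul_le {c : ℝ} (hc : 1 ≤ c) (x : ℝ) : lnlnPlus (c * x) ≤ c * lnlnPlus x := by
  set m := max x (Real.exp (Real.exp 1)) with hm
  have h2 : 2 ≤ Real.log m := two_le_log_max x
  have h0 : 0 < m := lt_max_of_lt_right (Real.exp_pos _)
  have hc0 : 0 < c := by linarith
  have hlc : 0 ≤ Real.log c := Real.log_nonneg hc
  have h3 : Real.log (max (c * x) (Real.exp (Real.exp 1))) ≤ Real.log c + Real.log m := by
    rw [← Real.log_mul hc0.ne' h0.ne']
    refine Real.log_le_log (lt_max_of_lt_right (Real.exp_pos _)) (max_le ?_ ?_)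
    · exact mul_le_mul_of_nonneg_left (le_max_left _ _) hc0.le
    · exact (le_max_right x _).trans (le_mul_of_one_le_left h0.le hc)
  have h4 : Real.log c + Real.log m ≤ c * Real.log m := by
    have := Real.log_le_sub_one_of_pos hc0
    nlinarith
  have h5 : lnlnPlus (c * x) ≤ Real.log (c * Real.log m) :=
    Real.log_le_log (by linarith [two_le_log_max (c * x)]) (h3.trans h4)
  rw [Real.log_mul hc0.ne' (by linarith)] at h5
  have h6 : 1 ≤ lnlnPlus x := one_le_lnlnPlus x
  have h7 : Real.log (Real.log m) = lnlnPlus x := rfl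
  have := Real.log_le_sub_one_of_pos hc0
  nlinarith

/-- The iterated logarithm is dominated by any linear function, up to a constant. -/
lemma lnlnPlus_le_linear {κ : ℝ} (hκ : 0 < κ) {x : ℝ} (hx : 0 < x) :
    lnlnPlus x ≤ κ * x + (1 / κ + 3) := by
  have h0 : 0 < max x (Real.exp (Real.exp 1)) := lt_max_of_lt_right (Real.exp_pos _)
  have h1 : lnlnPlus x ≤ Real.log (max x (Real.exp (Real.exp 1))) :=
    (Real.log_le_sub_one_of_pos (by linarith [two_le_log_max x])).trans (by linarith)
  have hk : 0 < 1 / κ := by positivity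
  have he : Real.exp 1 < 3 := by linarith [Real.exp_one_lt_d9]
  rcases le_total x (Real.exp (Real.exp 1)) with h | h
  · rw [max_eq_right h, Real.log_exp] at h1
    nlinarith [mul_pos hκ hx]
  · rw [max_eq_left h] at h1
    have h2 := Real.log_le_sub_one_of_pos (mul_pos hκ hx)
    rw [Real.log_mul hκ.ne' hx.ne'] at h2
    have h3 := Real.log_le_sub_one_of_pos hk
    rw [one_div, Real.log_inv] at h3
    rw [one_div]
    linarith

lemma lnlnPlus_le_self {x : ℝ} (hx : 1 ≤ x) : lnlnPlus x ≤ x := by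
  rcases le_total x (Real.exp (Real.exp 1)) with h | h
  · rw [lnlnPlus, max_eq_right h, Real.log_exp, Real.log_exp]; exact hx
  · have h1 := Real.log_le_sub_one_of_pos (show 0 < x by linarith)
    have h2 := two_le_log_max x
    rw [lnlnPlus, max_eq_left h]
    rw [max_eq_left h] at h2
    have := Real.log_le_sub_one_of_pos (show 0 < Real.log x by linarith)
    linarith

/-- The grid `λ_j = 1 / (4 * 2 ^ j)` of slopes of the linear bounds. -/
noncomputable def gridSlope (j : ℕ) : ℝ := 1 / (4 * 2 ^ j)

/-- The logarithm of the number `2 (j + 1) (j + 2)`, the price of the `j`-th slope: each of the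
two signs of that slope gets the fraction `1 / (2 (j + 1) (j + 2))` of the failure probability. -/
noncomputable def slopePrice (j : ℕ) : ℝ := Real.log (2 * ((j + 1) * (j + 2)))

/-- The lower envelope of the linear bounds `λ_j Q + (l + price j) / λ_j` is of the order of
`√(W (ln ln W + l))` with `W = Q + l + 1`: for the best `j` the first term is at most a quarter of
it and the second at most forty times it. -/
lemma le_of_forall_gridSlope {s Q l : ℝ} (hQ : 0 ≤ Q) (hl : 0 ≤ l)
    (h : ∀ j, s ≤ gridSlope j * Q + (l + slopePrice j) / gridSlope j) :
    s ≤ 41 * √((Q + l + 1) * (lnlnPlus (Q + l + 1) + l)) := by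
  set W := Q + l + 1 with hW
  have hW1 : 1 ≤ W := by linarith
  set g := lnlnPlus W with hg
  have hg1 : 1 ≤ g := one_le_lnlnPlus W
  set G := g + l with hG
  have hG1 : 1 ≤ G := by linarith
  have hGW : G ≤ 2 * W := by linarith [lnlnPlus_le_self hW1]
  set a := √W with ha
  set b := √G with hb
  have haa : a * a = W := Real.mul_self_sqrt (by linarith)
  have hbb : b * b = G := Real.mul_self_sqrt (by linarith)
  have ha0 : 0 < a := Real.sqrt_pos.2 (by linarith)
  have hb1 : 1 ≤ b := Real.one_le_sqrt.2 hG1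
  have hba : b ≤ 2 * a := by nlinarith
  rw [Real.sqrt_mul (by linarith)]
  -- the optimal slope is of the order of `b / a`
  obtain ⟨j, hj1, hj2⟩ := exists_nat_pow_near (x := 2 * a / b) (y := 2)
    (by rw [le_div_iff₀ (by linarith)]; linarith) (by norm_num)
  have h2j : (0 : ℝ) < 2 ^ j := by positivity
  have hj1' : (2 : ℝ) ^ j * b ≤ 2 * a := by rwa [le_div_iff₀ (by linarith)] at hj1
  have hj2' : 2 * a < 2 ^ j * 2 * b := by
    rwa [div_lt_iff₀ (by linarith), pow_succ] at hj2
  have e1 : gridSlope j * Q ≤ a * b / 4 := by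
    rw [gridSlope, one_div, inv_mul_le_iff₀ (by positivity)]
    nlinarith
  have e2 : slopePrice j ≤ 5 * g := by
    have hm2 := two_le_log_max W
    set m := Real.log (max W (Real.exp (Real.exp 1))) with hm
    have hlm : Real.log W ≤ m := Real.log_le_log (by linarith) (le_max_left _ _)
    have hgm : g = Real.log m := rfl
    have hjm : (j : ℝ) ≤ 1 + m := by
      have h4 : ((2 : ℝ) ^ j) ^ 2 ≤ 4 * W := by nlinarith
      have h5 := Real.log_le_log (by positivity) h4
      rw [Real.log_mul (by norm_num) (by linarith), Real.log_pow, Real.log_pow,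
        show (4 : ℝ) = 2 ^ 2 by norm_num, Real.log_pow] at h5
      push_cast at h5
      have := Real.log_two_gt_d9
      have := Real.log_two_lt_d9
      have hj0 : (0 : ℝ) ≤ j := Nat.cast_nonneg j
      nlinarith
    have h6 : (2 : ℝ) * ((j + 1) * (j + 2)) ≤ 2 ^ 4 * m ^ 2 := by
      have hj0 : (0 : ℝ) ≤ j := Nat.cast_nonneg j
      have : (j : ℝ) + 2 ≤ 5 / 2 * m := by linarith
      nlinarith
    have h7 := Real.log_le_log (by positivity) h6
    rw [Real.log_mul (show (2 : ℝ) ^ 4 ≠ 0 by norm_num) (by positivity), Real.log_pow,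
      Real.log_pow, ← hgm] at h7
    have := Real.log_two_lt_d9
    rw [slopePrice]
    push_cast at h7
    linarith
  have e3 : (l + slopePrice j) / gridSlope j ≤ 40 * (a * b) := by
    rw [gridSlope, one_div, div_inv_eq_mul]
    have h8 : l + slopePrice j ≤ 5 * (b * b) := by rw [hbb]; linarith
    calc (l + slopePrice j) * (4 * 2 ^ j) ≤ 5 * (b * b) * (4 * 2 ^ j) := by gcongr
      _ = 20 * b * (2 ^ j * b) := by ring
      _ ≤ 20 * b * (2 * a) := by gcongr
      _ = 40 * (a * b) := by ring
  have := h j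
  have : 0 ≤ a * b := by positivity
  linarith

/-- A bound by the sum of squares `Q ≤ 4 n` turns into a bound by the number `n` of summands. -/
lemma le_of_le_sqrt_of_le_card {s Q l n : ℝ} (hl : 0 ≤ l)
    (hQn : Q ≤ 4 * n) (hs : s ≤ 2 * n)
    (h : s ≤ 41 * √((Q + l + 1) * (lnlnPlus (Q + l + 1) + l))) :
    s ≤ 82 * (1 + l + √(4 * n * (lnlnPlus (4 * n) + l))) := by
  have hr := Real.sqrt_nonneg (4 * n * (lnlnPlus (4 * n) + l))
  rcases le_total (4 * n) (l + 1) with h1 | h1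
  · linarith
  · have h2 : lnlnPlus (Q + l + 1) ≤ 2 * lnlnPlus (4 * n) :=
      (lnlnPlus_mono (by linarith)).trans (lnlnPlus_mul_le one_le_two (4 * n))
    have h3 := one_le_lnlnPlus (Q + l + 1)
    have h4 : (Q + l + 1) * (lnlnPlus (Q + l + 1) + l) ≤
        2 ^ 2 * (4 * n * (lnlnPlus (4 * n) + l)) := by
      calc _ ≤ (2 * (4 * n)) * (2 * (lnlnPlus (4 * n) + l)) := by
            apply mul_le_mul <;> linarith
        _ = _ := by ring
    have h5 := Real.sqrt_le_sqrt h4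
    rw [Real.sqrt_mul (show (0 : ℝ) ≤ 2 ^ 2 by norm_num),
      Real.sqrt_sq (show (0 : ℝ) ≤ 2 by norm_num)] at h5
    linarith

/-- A bound by the sum of squares `Q` turns into a bound by any `v` with `Q ≤ v + 2 s`: the excess
`2 s` is absorbed, because the bound is of a smaller order than `Q`. -/
lemma exists_forall_le_of_le_add :
    ∃ C : ℝ, 0 < C ∧ ∀ s Q v l : ℝ, 0 ≤ Q → 0 ≤ v → 0 ≤ l → Q ≤ v + 2 * s →
      s ≤ 41 * √((Q + l + 1) * (lnlnPlus (Q + l + 1) + l)) →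
      s ≤ C * √((v + l + 1) * (lnlnPlus (v + l + 1) + l)) := by
  -- `κ` makes `41 ^ 2 * κ * W ^ 2 = (W / 8) ^ 2`
  obtain ⟨κ, hκ⟩ : ∃ κ : ℝ, κ = 1 / (8 * 41) ^ 2 := ⟨_, rfl⟩
  obtain ⟨A, hA⟩ : ∃ A : ℝ, A = 1 / κ + 3 := ⟨_, rfl⟩
  have hκ0 : 0 < κ := by rw [hκ]; positivity
  have hA1 : 1 ≤ A := by
    have : 0 < 1 / κ := by positivity
    rw [hA]; linarith
  -- `W` turns out to be at most `B` times the quantity that replaces it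
  obtain ⟨B, hB⟩ : ∃ B : ℝ, B = 2 + 8 * 41 ^ 2 * A := ⟨_, rfl⟩
  have hB1 : 1 ≤ B := by nlinarith
  refine ⟨41 * B, by positivity, fun s Q v l hQ hv hl hQv h => ?_⟩
  set W := Q + l + 1 with hW
  set Wv := v + l + 1 with hWv
  have hW1 : 1 ≤ W := by linarith
  have hg := lnlnPlus_le_linear hκ0 (show 0 < W by linarith)
  have hg1 := one_le_lnlnPlus W
  have hgv := one_le_lnlnPlus Wv
  have hs : s ≤ W / 4 + 2 * 41 ^ 2 * (A + l) := by
    have h1 : W * (lnlnPlus W + l) ≤ ((W / 4 + 2 * 41 ^ 2 * (A + l)) / 41) ^ 2 := by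
      have : W * (lnlnPlus W + l) ≤ W * (κ * W + A + l) := by
        gcongr
        linarith
      refine this.trans ?_
      rw [hκ]
      have : 0 ≤ A + l := by linarith
      nlinarith [sq_nonneg W, sq_nonneg (A + l), mul_nonneg this (show 0 ≤ W by linarith)]
    have h2 := Real.sqrt_le_sqrt h1
    rw [Real.sqrt_sq (by positivity)] at h2
    linarith
  have hWle : W ≤ B * Wv := by
    have : W ≤ 2 * Wv + 4 * (2 * 41 ^ 2 * (A + l)) := by
      have : 0 ≤ A + l := by linarith
      linarith
    have h3 : A + l ≤ A * Wv := by nlinarith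
    rw [hB]; linarith
  have hgW : lnlnPlus W ≤ B * lnlnPlus Wv := (lnlnPlus_mono hWle).trans (lnlnPlus_mul_le hB1 Wv)
  have h4 : W * (lnlnPlus W + l) ≤ B ^ 2 * (Wv * (lnlnPlus Wv + l)) := by
    calc _ ≤ (B * Wv) * (B * (lnlnPlus Wv + l)) := by
          apply mul_le_mul hWle _ (by linarith) (by positivity)
          nlinarith
      _ = _ := by ring
  have h5 := Real.sqrt_le_sqrt h4
  rw [Real.sqrt_mul (show 0 ≤ B ^ 2 by positivity), Real.sqrt_sq (show 0 ≤ B by linarith)] at h5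
  linarith

/-! ### Maximal inequality -/

/-- The running product of the `φ (X i)`, frozen as soon as it is at least `a`. -/
noncomputable def frozenProd {E : Type*} (φ : E → ENNReal) (a : ENNReal) :
    ℕ → (ℕ → E) → ENNReal
  | 0, _ => 1
  | n + 1, X => if a ≤ frozenProd φ a n X then frozenProd φ a n X
      else frozenProd φ a n X * φ (X n)

lemma measurable_iSup_comap {ι Ω E : Type*} {mE : MeasurableSpace E} (f : ι → Ω → E) {S : Set ι}
    {i : ι} (hi : i ∈ S) : Measurable[⨆ j ∈ S, MeasurableSpace.comap (f j) mE] (f i) :=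
  measurable_iff_comap_le.2
    (le_iSup₂_of_le (f := fun j (_ : j ∈ S) => MeasurableSpace.comap (f j) mE) i hi le_rfl)

section Ville

variable {E : Type*} {φ : E → ENNReal} {a : ENNReal}

lemma le_frozenProd_succ {n : ℕ} {X : ℕ → E} (h : a ≤ frozenProd φ a n X) :
    a ≤ frozenProd φ a (n + 1) X := by
  rw [frozenProd, if_pos h]; exact h

lemma frozenProd_eq_or_le (n : ℕ) (X : ℕ → E) :
    frozenProd φ a n X = ∏ i ∈ Finset.range n, φ (X i) ∨ a ≤ frozenProd φ a n X := by
  induction n with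
  | zero => left; simp [frozenProd]
  | succ n ih =>
    by_cases h : a ≤ frozenProd φ a n X
    · exact Or.inr (le_frozenProd_succ h)
    · rcases ih with ih | ih
      · left
        rw [frozenProd, if_neg h, ih, Finset.prod_range_succ]
      · exact absurd ih h

lemma measurable_frozenProd [MeasurableSpace E] (hφ : Measurable φ) {m : MeasurableSpace (ℕ → E)}
    {n : ℕ} (hm : ∀ i < n, Measurable[m] (fun X : ℕ → E => X i)) :
    Measurable[m] (frozenProd φ a n) := by
  induction n with
  | zero => exact measurable_const
  | succ n ih =>
    have h := ih fun i hi => hm i (by omega)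
    exact Measurable.ite (measurableSet_le measurable_const h) h
      (h.mul (hφ.comp (hm n (by omega))))

/-- The frozen product is a supermartingale when `φ` has mean at most `1`. -/
lemma lintegral_frozenProd_le_one [MeasurableSpace E] (ν : Measure E) [IsProbabilityMeasure ν]
    (hφ : Measurable φ) (h1 : ∫⁻ x, φ x ∂ν ≤ 1) (n : ℕ) :
    ∫⁻ X, frozenProd φ a n X ∂(Measure.infinitePi (fun _ : ℕ => ν)) ≤ 1 := by
  set ρ := Measure.infinitePi (fun _ : ℕ => ν) with hρ
  induction n with
  | zero => simp [frozenProd]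
  | succ n ih =>
    refine le_trans ?_ ih
    have hmeas : Measurable (frozenProd φ a n) :=
      measurable_frozenProd hφ fun i _ => measurable_pi_apply i
    set s := {X : ℕ → E | a ≤ frozenProd φ a n X} with hs
    have hsm : MeasurableSet s := measurableSet_le measurable_const hmeas
    have hind : iIndepFun (fun (i : ℕ) (X : ℕ → E) => X i) ρ :=
      iIndepFun_infinitePi (X := fun _ x => x) fun _ => measurable_id
    have hind2 := indep_iSup_of_disjoint (fun i => (measurable_pi_apply i).comap_le) hind
      (S := Set.Iio n) (T := {n}) (by simp)
    -- before freezing, the new factor is independent of the past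
    have hprod : ∫⁻ X, sᶜ.indicator (frozenProd φ a n) X * φ (X n) ∂ρ =
        (∫⁻ X, sᶜ.indicator (frozenProd φ a n) X ∂ρ) * ∫⁻ X, φ (X n) ∂ρ := by
      refine lintegral_mul_eq_lintegral_mul_lintegral_of_independent_measurableSpace
        (iSup₂_le fun i _ => (measurable_pi_apply i).comap_le)
        (iSup₂_le fun i _ => (measurable_pi_apply i).comap_le) hind2 ?_ ?_
      · have h := measurable_frozenProd (a := a) (n := n) hφ fun i hi =>
          measurable_iSup_comap (fun (i : ℕ) (X : ℕ → E) => X i) (S := Set.Iio n) hi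
        exact h.indicator (measurableSet_le measurable_const h).compl
      · exact hφ.comp (measurable_iSup_comap (fun (i : ℕ) (X : ℕ → E) => X i)
          (Set.mem_singleton n))
    have hφn : ∫⁻ X, φ (X n) ∂ρ ≤ 1 := by
      rwa [(measurePreserving_eval_infinitePi (fun _ : ℕ => ν) n).lintegral_comp hφ]
    calc ∫⁻ X, frozenProd φ a (n + 1) X ∂ρ
        = ∫⁻ X, (s.indicator (frozenProd φ a n) X +
            sᶜ.indicator (frozenProd φ a n) X * φ (X n)) ∂ρ := by
          refine lintegral_congr fun X => ?_
          by_cases h : a ≤ frozenProd φ a n X <;> simp [frozenProd, hs, h]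
      _ = ∫⁻ X, s.indicator (frozenProd φ a n) X ∂ρ +
            ∫⁻ X, sᶜ.indicator (frozenProd φ a n) X * φ (X n) ∂ρ :=
          lintegral_add_left (hmeas.indicator hsm) _
      _ ≤ ∫⁻ X, s.indicator (frozenProd φ a n) X ∂ρ +
            ∫⁻ X, sᶜ.indicator (frozenProd φ a n) X ∂ρ := by
          rw [hprod]
          gcongr
          exact mul_le_of_le_one_right' hφn
      _ = ∫⁻ X, frozenProd φ a n X ∂ρ := by
          rw [← lintegral_add_left (hmeas.indicator hsm)]
          exact lintegral_congr fun X => Set.indicator_self_add_compl_apply _ _ _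

/-- Ville's inequality for products of i.i.d. factors of mean at most `1`. -/
lemma mul_measure_exists_le_prod [MeasurableSpace E] (ν : Measure E) [IsProbabilityMeasure ν]
    (hφ : Measurable φ) (h1 : ∫⁻ x, φ x ∂ν ≤ 1) (a : ENNReal) :
    a * Measure.infinitePi (fun _ : ℕ => ν) {X | ∃ n, a ≤ ∏ i ∈ Finset.range n, φ (X i)} ≤ 1 := by
  have hsub : {X : ℕ → E | ∃ n, a ≤ ∏ i ∈ Finset.range n, φ (X i)} ⊆
      ⋃ n, {X | a ≤ frozenProd φ a n X} := by
    rintro X ⟨n, hn⟩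
    refine Set.mem_iUnion.2 ⟨n, ?_⟩
    rcases frozenProd_eq_or_le (φ := φ) (a := a) n X with h | h
    · exact hn.trans_eq h.symm
    · exact h
  have hmono : Monotone fun n => {X : ℕ → E | a ≤ frozenProd φ a n X} :=
    monotone_nat_of_le_succ fun n X hX => le_frozenProd_succ hX
  refine (mul_le_mul_right (measure_mono hsub) a).trans ?_
  rw [hmono.measure_iUnion, ENNReal.mul_iSup]
  refine iSup_le fun n => ?_
  exact (mul_meas_ge_le_lintegral
    (measurable_frozenProd hφ fun i _ => measurable_pi_apply i) a).trans
    (lintegral_frozenProd_le_one ν hφ h1 n)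

end Ville

/-! ### Self-normalised concentration and admissible constants -/

lemma exp_sub_sq_le {x : ℝ} (h1 : -(1 / 2) ≤ x) (h2 : x ≤ 1 / 2) :
    Real.exp (x - x ^ 2) ≤ 1 + x := by
  rcases le_total 0 x with h | h
  · have h3 := Real.abs_exp_sub_one_sub_id_le (x := x - x ^ 2)
      (by rw [abs_le]; constructor <;> nlinarith)
    have h4 := (abs_le.1 h3).2
    have h5 : (x - x ^ 2) ^ 2 ≤ x ^ 2 := by
      apply pow_le_pow_left₀ <;> nlinarith
    linarith
  · obtain ⟨y, rfl⟩ : ∃ y, x = -y := ⟨-x, by ring⟩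
    have hy : 0 ≤ y := by linarith
    have hz : 0 ≤ y + y ^ 2 := by positivity
    have h3 := Real.quadratic_le_exp_of_nonneg hz
    rw [show -y - (-y) ^ 2 = -(y + y ^ 2) by ring, Real.exp_neg,
      inv_le_iff_one_le_mul₀ (Real.exp_pos _)]
    have h4 : 1 ≤ (1 + -y) * (1 + (y + y ^ 2) + (y + y ^ 2) ^ 2 / 2) := by
      have : 0 ≤ y ^ 2 * (1 - y - y ^ 2 - y ^ 3) := by
        apply mul_nonneg (by positivity)
        have : y ^ 2 ≤ (1 / 2) ^ 2 := by gcongr; linarith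
        have : y ^ 3 ≤ (1 / 2) ^ 3 := by gcongr; linarith
        linarith
      nlinarith
    refine h4.trans ?_
    gcongr
    linarith

lemma sum_map_range (X : ℕ → ℝ) (n : ℕ) :
    ((List.range n).map X).sum = ∑ i ∈ Finset.range n, X i := rfl

/-- Ville's inequality for `exp (c S_n - c ^ 2 Q_n)`, with `S_n` the partial sums and `Q_n` the
partial sums of squares. -/
lemma measure_exists_le_linear_le (ν : Measure ℝ) [IsProbabilityMeasure ν]
    (hν : ∀ᵐ x ∂ν, x ∈ Set.Icc (-2 : ℝ) 2) (hν0 : ∫ x, x ∂ν = 0) {c : ℝ} (hc : |c| ≤ 1 / 4)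
    (a : ℝ) :
    Measure.infinitePi (fun _ : ℕ => ν) {X | ∃ n, a ≤ c * ∑ i ∈ Finset.range n, X i -
      c ^ 2 * ∑ i ∈ Finset.range n, X i ^ 2} ≤ ENNReal.ofReal (Real.exp (-a)) := by
  have hint : Integrable (fun x : ℝ => x) ν := by
    refine Integrable.of_bound measurable_id.aestronglyMeasurable 2 ?_
    filter_upwards [hν] with x hx
    exact abs_le.2 hx
  have hcx : ∀ x ∈ Set.Icc (-2 : ℝ) 2, |c * x| ≤ 1 / 2 := by
    intro x hx
    rw [abs_mul]
    calc |c| * |x| ≤ 1 / 4 * 2 := by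
          gcongr
          exact abs_le.2 hx
      _ = 1 / 2 := by norm_num
  have h1 : ∫⁻ x, ENNReal.ofReal (Real.exp (c * x - (c * x) ^ 2)) ∂ν ≤ 1 := by
    calc _ ≤ ∫⁻ x, ENNReal.ofReal (1 + c * x) ∂ν := by
          refine lintegral_mono_ae ?_
          filter_upwards [hν] with x hx
          have h2 := hcx x hx
          exact ENNReal.ofReal_le_ofReal (exp_sub_sq_le (abs_le.1 h2).1 (abs_le.1 h2).2)
      _ = ENNReal.ofReal (∫ x, (1 + c * x) ∂ν) := by
          refine (ofReal_integral_eq_lintegral_ofReal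
            ((integrable_const _).add (hint.const_mul c)) ?_).symm
          filter_upwards [hν] with x hx
          have h2 := hcx x hx
          change (0 : ℝ) ≤ 1 + c * x
          linarith [(abs_le.1 h2).1]
      _ = 1 := by
          rw [integral_add (integrable_const _) (hint.const_mul c), integral_const_mul, hν0]
          simp
  have h2 := mul_measure_exists_le_prod ν
    (φ := fun x => ENNReal.ofReal (Real.exp (c * x - (c * x) ^ 2))) (by fun_prop) h1
    (ENNReal.ofReal (Real.exp a))
  have h3 : {X : ℕ → ℝ | ∃ n, a ≤ c * ∑ i ∈ Finset.range n, X i -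
      c ^ 2 * ∑ i ∈ Finset.range n, X i ^ 2} ⊆ {X | ∃ n, ENNReal.ofReal (Real.exp a) ≤
        ∏ i ∈ Finset.range n, ENNReal.ofReal (Real.exp (c * X i - (c * X i) ^ 2))} := by
    rintro X ⟨n, hn⟩
    refine ⟨n, ?_⟩
    rw [← ENNReal.ofReal_prod_of_nonneg fun _ _ => (Real.exp_pos _).le, ← Real.exp_sum]
    refine ENNReal.ofReal_le_ofReal (Real.exp_le_exp.2 (hn.trans_eq ?_))
    simp only [mul_pow, Finset.sum_sub_distrib, Finset.mul_sum]
  refine (measure_mono h3).trans ?_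
  rw [Real.exp_neg, ENNReal.ofReal_inv_of_pos (Real.exp_pos _), ENNReal.le_inv_iff_mul_le, mul_comm]
  exact h2

lemma tsum_slopeWeight_le (δ : ℝ) (hδ : 0 ≤ δ) :
    ∑' j : ℕ, ENNReal.ofReal (δ / ((j + 1) * (j + 2))) ≤ ENNReal.ofReal δ := by
  rw [ENNReal.tsum_eq_iSup_nat]
  refine iSup_le fun n => ?_
  rw [← ENNReal.ofReal_sum_of_nonneg fun _ _ => by positivity]
  refine ENNReal.ofReal_le_ofReal ?_
  have h : ∑ j ∈ Finset.range n, δ / (((j : ℝ) + 1) * (j + 2)) = δ - δ / (n + 1) := by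
    induction n with
    | zero => simp
    | succ n ih =>
      rw [Finset.sum_range_succ, ih]
      push_cast
      field_simp
      ring
  rw [h]
  have : 0 ≤ δ / ((n : ℝ) + 1) := by positivity
  linarith

/-- Uniform self-normalised concentration: with probability at least `1 - δ` all the partial sums
are bounded in terms of the partial sums of squares. -/
lemma measure_compl_selfNormalised_le (ν : Measure ℝ) [IsProbabilityMeasure ν]
    (hν : ∀ᵐ x ∂ν, x ∈ Set.Icc (-2 : ℝ) 2) (hν0 : ∫ x, x ∂ν = 0) {δ : ℝ} (hδ : 0 < δ)
    (hδ1 : δ < 1) :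
    Measure.infinitePi (fun _ : ℕ => ν) {X | ∀ n, |∑ i ∈ Finset.range n, X i| ≤
      41 * √((∑ i ∈ Finset.range n, X i ^ 2 + Real.log (1 / δ) + 1) *
        (lnlnPlus (∑ i ∈ Finset.range n, X i ^ 2 + Real.log (1 / δ) + 1) +
          Real.log (1 / δ)))}ᶜ ≤ ENNReal.ofReal δ := by
  set l := Real.log (1 / δ) with hl
  have hl0 : 0 ≤ l := Real.log_nonneg (by rw [le_div_iff₀ hδ]; linarith)
  set bad : ℝ → ℕ → Set (ℕ → ℝ) := fun s j => {X | ∃ n, l + slopePrice j ≤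
    s * gridSlope j * ∑ i ∈ Finset.range n, X i -
      (s * gridSlope j) ^ 2 * ∑ i ∈ Finset.range n, X i ^ 2} with hbad
  have hsub : {X : ℕ → ℝ | ∀ n, |∑ i ∈ Finset.range n, X i| ≤
      41 * √((∑ i ∈ Finset.range n, X i ^ 2 + l + 1) *
        (lnlnPlus (∑ i ∈ Finset.range n, X i ^ 2 + l + 1) + l))}ᶜ ⊆
      ⋃ j, (bad 1 j ∪ bad (-1) j) := by
    intro X hX
    by_contra hX2
    refine hX fun n => ?_
    refine le_of_forall_gridSlope (Finset.sum_nonneg fun i _ => sq_nonneg _) hl0 fun j => ?_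
    have hj : X ∉ bad 1 j ∪ bad (-1) j := fun h => hX2 (Set.mem_iUnion.2 ⟨j, h⟩)
    rw [Set.mem_union, not_or] at hj
    simp only [hbad, Set.mem_ofPred_eq, not_exists, not_le] at hj
    have hj1 := hj.1 n
    have hj2 := hj.2 n
    have hs : 0 < gridSlope j := by unfold gridSlope; positivity
    rw [← sub_le_iff_le_add', le_div_iff₀ hs]
    rcases abs_cases (∑ i ∈ Finset.range n, X i) with ⟨h, _⟩ | ⟨h, _⟩ <;> rw [h] <;> nlinarith
  refine (measure_mono hsub).trans ((measure_iUnion_le _).trans ?_)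
  refine le_trans (ENNReal.tsum_le_tsum fun j => ?_) (tsum_slopeWeight_le δ hδ.le)
  have hslope : gridSlope j ≤ 1 / 4 := by
    rw [gridSlope]
    apply one_div_le_one_div_of_le (by norm_num)
    have : (1 : ℝ) ≤ 2 ^ j := one_le_pow₀ one_le_two
    linarith
  have hs : 0 < gridSlope j := by unfold gridSlope; positivity
  have hexp : Real.exp (-(l + slopePrice j)) = δ / ((j + 1) * (j + 2)) / 2 := by
    rw [hl, slopePrice, neg_add, Real.exp_add, ← Real.log_inv, ← Real.log_inv,
      Real.exp_log (by positivity), Real.exp_log (by positivity)]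
    field_simp
  calc _ ≤ ENNReal.ofReal (Real.exp (-(l + slopePrice j))) +
        ENNReal.ofReal (Real.exp (-(l + slopePrice j))) := by
        refine (measure_union_le _ _).trans (add_le_add ?_ ?_) <;>
        · refine measure_exists_le_linear_le ν hν hν0 ?_ _
          rw [abs_mul, abs_of_pos hs]
          simpa using hslope
    _ = _ := by
        rw [hexp, ← ENNReal.ofReal_add (by positivity) (by positivity), add_halves]

lemma ae_forall_mem_Icc (ν : Measure ℝ) [IsProbabilityMeasure ν]
    (hν : ∀ᵐ x ∂ν, x ∈ Set.Icc (-2 : ℝ) 2) :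
    ∀ᵐ X ∂(Measure.infinitePi (fun _ : ℕ => ν)), ∀ i, X i ∈ Set.Icc (-2 : ℝ) 2 :=
  ae_all_iff.2 fun i =>
    (measurePreserving_eval_infinitePi (fun _ : ℕ => ν) i).quasiMeasurePreserving.ae hν

lemma one_sub_le_measureReal {α : Type*} [MeasurableSpace α] {μ : Measure α}
    [IsProbabilityMeasure μ] {s t : Set α} {δ : ℝ} (hδ : 0 ≤ δ) (h : μ t ≤ ENNReal.ofReal δ)
    (hst : ∀ᵐ x ∂μ, x ∉ t → x ∈ s) : 1 - δ ≤ μ.real s := by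
  have h1 : μ sᶜ ≤ μ t := by
    refine measure_mono_ae ?_
    filter_upwards [hst] with x hx hxs
    by_contra hxt
    exact hxs (hx hxt)
  have h2 : 1 ≤ μ s + μ sᶜ := by
    rw [← measure_univ (μ := μ), ← Set.union_compl_self s]
    exact measure_union_le _ _
  have h3 : (1 : ENNReal) ≤ ENNReal.ofReal (μ.real s + δ) := by
    rw [ENNReal.ofReal_add measureReal_nonneg hδ, ofReal_measureReal]
    exact h2.trans (by gcongr; exact h1.trans h)
  rw [ENNReal.one_le_ofReal] at h3
  linarith

lemma sum_sq_le_of_mem_Icc {X : ℕ → ℝ} (hX : ∀ i, X i ∈ Set.Icc (-2 : ℝ) 2) (n : ℕ) :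
    ∑ i ∈ Finset.range n, X i ^ 2 ≤ 4 * n := by
  calc _ ≤ ∑ i ∈ Finset.range n, (4 : ℝ) := by
        refine Finset.sum_le_sum fun i _ => ?_
        have := hX i
        nlinarith [this.1, this.2]
    _ = 4 * n := by simp [mul_comm]

lemma abs_sum_le_of_mem_Icc {X : ℕ → ℝ} (hX : ∀ i, X i ∈ Set.Icc (-2 : ℝ) 2) (n : ℕ) :
    |∑ i ∈ Finset.range n, X i| ≤ 2 * n := by
  calc _ ≤ ∑ i ∈ Finset.range n, |X i| := Finset.abs_sum_le_sum_abs _ _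
    _ ≤ ∑ i ∈ Finset.range n, (2 : ℝ) := Finset.sum_le_sum fun i _ => abs_le.2 (hX i)
    _ = 2 * n := by simp [mul_comm]

lemma empVar_map_range (X : ℕ → ℝ) (n : ℕ) :
    empVar ((List.range n).map X) = n / (n - 1) *
      (∑ i ∈ Finset.range n, X i ^ 2 - 1 / n * (∑ i ∈ Finset.range n, X i) ^ 2) := by
  rw [empVar, List.map_map, sum_map_range, sum_map_range]
  simp

lemma empVar_map_range_nonneg {X : ℕ → ℝ} {n : ℕ} (hn : 2 ≤ n) :
    0 ≤ empVar ((List.range n).map X) := by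
  have hn2 : (2 : ℝ) ≤ n := by exact_mod_cast hn
  have h := sq_sum_le_card_mul_sum_sq (s := Finset.range n) (f := X)
  rw [Finset.card_range] at h
  rw [empVar_map_range]
  refine mul_nonneg (div_nonneg (by linarith) (by linarith)) ?_
  rw [sub_nonneg, one_div, inv_mul_le_iff₀ (by linarith)]
  exact h

/-- The sum of squares exceeds the empirical variance by at most twice the absolute sum. -/
lemma sum_sq_le_empVar_add {X : ℕ → ℝ} (hX : ∀ i, X i ∈ Set.Icc (-2 : ℝ) 2) {n : ℕ}
    (hn : 2 ≤ n) : ∑ i ∈ Finset.range n, X i ^ 2 ≤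
      empVar ((List.range n).map X) + 2 * |∑ i ∈ Finset.range n, X i| := by
  have hn2 : (2 : ℝ) ≤ n := by exact_mod_cast hn
  have h := sq_sum_le_card_mul_sum_sq (s := Finset.range n) (f := X)
  have h2 := abs_sum_le_of_mem_Icc hX n
  rw [Finset.card_range] at h
  rw [empVar_map_range]
  set S := ∑ i ∈ Finset.range n, X i
  set Q := ∑ i ∈ Finset.range n, X i ^ 2
  have h3 : 0 ≤ Q - 1 / n * S ^ 2 := by
    rw [sub_nonneg, one_div, inv_mul_le_iff₀ (by linarith)]
    exact h
  have h4 : 1 / (n : ℝ) * S ^ 2 ≤ 2 * |S| := by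
    rw [one_div, inv_mul_le_iff₀ (by linarith), ← sq_abs]
    nlinarith [abs_nonneg S]
  have h5 : 1 ≤ (n : ℝ) / (n - 1) := by
    rw [le_div_iff₀ (by linarith)]
    linarith
  nlinarith

lemma exists_isMeanConstant : ∃ D₀ : ℝ, IsMeanConstant D₀ := by
  refine ⟨82, by norm_num, fun ν _ hν hν0 δ hδ hδ1 => ?_⟩
  refine one_sub_le_measureReal hδ.le (measure_compl_selfNormalised_le ν hν hν0 hδ hδ1) ?_
  filter_upwards [ae_forall_mem_Icc ν hν] with X hX hgood n _
  rw [Set.notMem_compl_iff] at hgood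
  exact le_of_le_sqrt_of_le_card (Real.log_nonneg (by rw [le_div_iff₀ hδ]; linarith))
    (sum_sq_le_of_mem_Icc hX n) (abs_sum_le_of_mem_Icc hX n) (hgood n)

lemma exists_isVarConstant : ∃ D₁ : ℝ, IsVarConstant D₁ := by
  obtain ⟨C, hC, h⟩ := exists_forall_le_of_le_add
  refine ⟨C, hC, fun ν _ hν hν0 δ hδ hδ1 => ?_⟩
  refine one_sub_le_measureReal hδ.le (measure_compl_selfNormalised_le ν hν hν0 hδ hδ1) ?_
  filter_upwards [ae_forall_mem_Icc ν hν] with X hX hgood n hn _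
  rw [Set.notMem_compl_iff] at hgood
  have hl : 0 ≤ Real.log (1 / δ) := Real.log_nonneg (by rw [le_div_iff₀ hδ]; linarith)
  refine (h _ _ _ _ (Finset.sum_nonneg fun i _ => sq_nonneg _) (empVar_map_range_nonneg hn) hl
    (sum_sq_le_empVar_add hX hn) (hgood n)).trans ?_
  rw [qThreshold]
  gcongr
  linarith

/-! ### The tests on i.i.d. arrays of nonpositive mean -/

lemma measurable_lnlnPlus : Measurable lnlnPlus := by
  unfold lnlnPlus
  fun_prop

lemma measurable_qThreshold_empVar (D δ : ℝ) (n : ℕ) :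
    Measurable fun X : ℕ → ℝ => qThreshold D (empVar ((List.range n).map X)) δ := by
  have h : Measurable fun v : ℝ => qThreshold D v δ := by
    have := measurable_lnlnPlus
    unfold qThreshold
    fun_prop
  refine h.comp ?_
  simp only [empVar_map_range]
  fun_prop

lemma log_one_div_lt {η δ : ℝ} (hη : 0 < η) (h : η < δ) :
    Real.log (1 / δ) < Real.log (1 / η) :=
  Real.log_lt_log (one_div_pos.2 (hη.trans h)) (one_div_lt_one_div_of_lt hη h)

lemma pThreshold_lt {D η δ : ℝ} (hD : 0 < D) (hη : 0 < η) (h : η < δ) (n : ℕ) :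
    pThreshold D n δ < pThreshold D n η := by
  have hl := log_one_div_lt hη h
  unfold pThreshold
  refine mul_lt_mul_of_pos_left ?_ hD
  refine add_lt_add_of_lt_of_le (by linarith) (Real.sqrt_le_sqrt ?_)
  gcongr

lemma qThreshold_lt {D η δ v : ℝ} (hD : 0 < D) (hη : 0 < η) (h : η < δ) (hδ : δ ≤ 1)
    (hv : 0 ≤ v) : qThreshold D v δ < qThreshold D v η := by
  have hl := log_one_div_lt hη h
  have hl0 : 0 ≤ Real.log (1 / δ) :=
    Real.log_nonneg (by rw [le_div_iff₀ (hη.trans h)]; linarith)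
  have hg := one_le_lnlnPlus (v + Real.log (1 / δ) + 1)
  unfold qThreshold
  refine mul_lt_mul_of_pos_left ?_ hD
  refine add_lt_add_of_lt_of_le (by linarith) (Real.sqrt_le_sqrt ?_)
  refine mul_le_mul (by linarith) ?_ (by linarith) (by linarith)
  exact add_le_add (lnlnPlus_mono (by linarith)) hl.le

lemma measure_compl_le_of_one_sub_le {α : Type*} [MeasurableSpace α] {μ : Measure α}
    [IsProbabilityMeasure μ] {s : Set α} (hs : MeasurableSet s) {δ : ℝ}
    (h : 1 - δ ≤ μ.real s) : μ sᶜ ≤ ENNReal.ofReal δ := by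
  rw [← ofReal_measureReal, probReal_compl_eq_one_sub hs]
  exact ENNReal.ofReal_le_ofReal (by linarith)

lemma le_ofReal_of_forall_lt {x : ENNReal} {η : ℝ} (hη1 : η < 1)
    (h : ∀ δ, η < δ → δ < 1 → x ≤ ENNReal.ofReal δ) : x ≤ ENNReal.ofReal η := by
  have ht : Filter.Tendsto ENNReal.ofReal (nhdsWithin η (Set.Ioi η))
      (nhds (ENNReal.ofReal η)) :=
    ENNReal.continuous_ofReal.continuousAt.tendsto.mono_left nhdsWithin_le_nhds
  refine ge_of_tendsto ht ?_
  filter_upwards [Ioo_mem_nhdsGT hη1] with δ hδ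
  exact h δ hδ.1 hδ.2

section Centred

variable {ν : Measure ℝ} [IsProbabilityMeasure ν]

/-- The concentration inequality with the complementary event made non-strict: the thresholds are
strictly decreasing in the confidence level, so the level `η` is the limit of levels `δ > η`. -/
lemma measure_exists_pThreshold_le {D₀ : ℝ} (hD : IsMeanConstant D₀)
    (hν : ∀ᵐ x ∂ν, x ∈ Set.Icc (-2 : ℝ) 2) (hν0 : ∫ x, x ∂ν = 0) {η : ℝ} (hη : 0 < η)
    (hη1 : η < 1) :
    Measure.infinitePi (fun _ : ℕ => ν) {X | ∃ n : ℕ, 0 < n ∧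
      pThreshold D₀ n η ≤ |((List.range n).map X).sum|} ≤ ENNReal.ofReal η := by
  refine le_ofReal_of_forall_lt hη1 fun δ hδ hδ1 => ?_
  have hms : MeasurableSet {X : ℕ → ℝ | ∀ n : ℕ, 0 < n →
      |((List.range n).map X).sum| ≤ pThreshold D₀ n δ} := by
    simp only [sum_map_range, Set.ofPred_forall]
    refine MeasurableSet.iInter fun n => MeasurableSet.iInter fun _ => ?_
    exact measurableSet_le (by fun_prop) measurable_const
  refine le_trans (measure_mono ?_)
    (measure_compl_le_of_one_sub_le hms (hD.2 ν hν hν0 δ (hη.trans hδ) hδ1))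
  rintro X ⟨n, hn0, hn⟩ hX
  exact absurd (hX n hn0) (not_le.2 ((pThreshold_lt hD.1 hη hδ n).trans_le hn))

lemma measure_exists_qThreshold_le {D₁ : ℝ} (hD : IsVarConstant D₁)
    (hν : ∀ᵐ x ∂ν, x ∈ Set.Icc (-2 : ℝ) 2) (hν0 : ∫ x, x ∂ν = 0) {η : ℝ} (hη : 0 < η)
    (hη1 : η < 1) :
    Measure.infinitePi (fun _ : ℕ => ν) {X | ∃ n : ℕ, 2 ≤ n ∧ Real.log (1 / η) ≤ n ∧
      qThreshold D₁ (empVar ((List.range n).map X)) η ≤ |((List.range n).map X).sum|} ≤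
      ENNReal.ofReal η := by
  refine le_ofReal_of_forall_lt hη1 fun δ hδ hδ1 => ?_
  have hms : MeasurableSet {X : ℕ → ℝ | ∀ n : ℕ, 2 ≤ n → Real.log (1 / δ) ≤ n →
      |((List.range n).map X).sum| ≤ qThreshold D₁ (empVar ((List.range n).map X)) δ} := by
    simp only [Set.ofPred_forall]
    refine MeasurableSet.iInter fun n => MeasurableSet.iInter fun _ =>
      MeasurableSet.iInter fun _ => ?_
    refine measurableSet_le ?_ (measurable_qThreshold_empVar _ _ _)
    simp only [sum_map_range]
    fun_prop
  refine le_trans (measure_mono ?_)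
    (measure_compl_le_of_one_sub_le hms (hD.2 ν hν hν0 δ (hη.trans hδ) hδ1))
  rintro X ⟨n, hn2, hnl, hn⟩ hX
  exact absurd (hX n hn2 ((log_one_div_lt hη hδ).le.trans hnl))
    (not_le.2 ((qThreshold_lt hD.1 hη hδ hδ1.le (empVar_map_range_nonneg hn2)).trans_le hn))

end Centred

lemma empVar_map_sub (X : ℕ → ℝ) (c : ℝ) {n : ℕ} (hn : 0 < n) :
    empVar ((List.range n).map fun i => X i - c) = empVar ((List.range n).map X) := by
  have hn' : (n : ℝ) ≠ 0 := by positivity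
  rw [empVar_map_range, empVar_map_range]
  congr 1
  simp only [sub_sq, Finset.sum_add_distrib, Finset.sum_sub_distrib, ← Finset.sum_mul,
    ← Finset.mul_sum, Finset.sum_const, Finset.card_range, nsmul_eq_mul]
  field_simp
  ring

section Shifted

variable {ν : Measure ℝ} [IsProbabilityMeasure ν]

lemma integral_mem_Icc (hν : ∀ᵐ x ∂ν, x ∈ Set.Icc (-1 : ℝ) 1) :
    Integrable (fun x : ℝ => x) ν ∧ ∫ x, x ∂ν ∈ Set.Icc (-1 : ℝ) 1 := by
  have hint : Integrable (fun x : ℝ => x) ν := by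
    refine Integrable.of_bound measurable_id.aestronglyMeasurable 1 ?_
    filter_upwards [hν] with x hx
    exact abs_le.2 hx
  refine ⟨hint, abs_le.1 ?_⟩
  have h := norm_integral_le_of_norm_le_const (μ := ν) (f := fun x : ℝ => x) (C := 1) (by
    filter_upwards [hν] with x hx
    exact abs_le.2 hx)
  simpa using h

/-- Subtracting the mean of a law on `[-1,1]` gives a centred law on `[-2,2]`. -/
lemma map_sub_integral (hν : ∀ᵐ x ∂ν, x ∈ Set.Icc (-1 : ℝ) 1) :
    (∀ᵐ x ∂(ν.map fun x => x - ∫ y, y ∂ν), x ∈ Set.Icc (-2 : ℝ) 2) ∧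
      ∫ x, x ∂(ν.map fun x => x - ∫ y, y ∂ν) = 0 := by
  obtain ⟨hint, hm⟩ := integral_mem_Icc hν
  constructor
  · refine (ae_map_iff (p := fun x => x ∈ Set.Icc (-2 : ℝ) 2)
      (by fun_prop : Measurable fun x : ℝ => x - ∫ y, y ∂ν).aemeasurable measurableSet_Icc).2 ?_
    filter_upwards [hν] with x hx
    constructor <;> linarith [hx.1, hx.2, hm.1, hm.2]
  · rw [integral_map (by fun_prop) (by fun_prop), integral_sub hint (integrable_const _)]
    simp

lemma measure_exists_checkSignificant_le {D₀ : ℝ} (hD : IsMeanConstant D₀)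
    (hν : ∀ᵐ x ∂ν, x ∈ Set.Icc (-1 : ℝ) 1) (hν0 : ∫ x, x ∂ν ≤ 0) {η : ℝ} (hη : 0 < η)
    (hη1 : η < 1) :
    Measure.infinitePi (fun _ : ℕ => ν)
      {X | ∃ n : ℕ, CheckSignificant D₀ ((List.range n).map X) η} ≤ ENNReal.ofReal η := by
  set c := ∫ y, y ∂ν with hc
  have hp : IsProbabilityMeasure (ν.map fun x => x - c) :=
    Measure.isProbabilityMeasure_map (by fun_prop)
  obtain ⟨h1, h2⟩ := map_sub_integral hν
  refine le_trans ?_ (measure_exists_pThreshold_le hD h1 h2 hη hη1)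
  rw [← Measure.infinitePi_map_pi (fun _ : ℕ => ν) (f := fun _ x => x - c)
    (fun _ => by fun_prop)]
  refine le_trans (measure_mono ?_) (Measure.le_map_apply
    (by fun_prop : Measurable fun (X : ℕ → ℝ) i => X i - c).aemeasurable _)
  rintro X ⟨n, hn⟩
  rw [CheckSignificant, List.length_map, List.length_range] at hn
  rcases Nat.eq_zero_or_pos n with rfl | hn0
  -- the empty array does not pass the test, as its threshold is positive
  · have hl : 0 ≤ Real.log (1 / η) := Real.log_nonneg (by rw [le_div_iff₀ hη]; linarith)
    have : 0 < D₀ * (1 + Real.log (1 / η)) := mul_pos hD.1 (by linarith)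
    simp [pThreshold] at hn this
    linarith
  · refine ⟨n, hn0, hn.trans (le_trans ?_ (le_abs_self _))⟩
    simp only [sum_map_range, Finset.sum_sub_distrib, Finset.sum_const, Finset.card_range,
      nsmul_eq_mul]
    nlinarith [(Nat.cast_nonneg n : (0 : ℝ) ≤ n)]

/-- The level is at most `1/4 < 1/e`, so that the test never succeeds on arrays of length one, for
which the empirical variance is not defined. -/
lemma measure_exists_checkSignificantVar_le {D₁ : ℝ} (hD : IsVarConstant D₁)
    (hν : ∀ᵐ x ∂ν, x ∈ Set.Icc (-1 : ℝ) 1) (hν0 : ∫ x, x ∂ν ≤ 0) {η : ℝ} (hη : 0 < η)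
    (hη1 : η ≤ 1 / 4) :
    Measure.infinitePi (fun _ : ℕ => ν)
      {X | ∃ n : ℕ, CheckSignificantVar D₁ ((List.range n).map X) η} ≤ ENNReal.ofReal η := by
  set c := ∫ y, y ∂ν with hc
  have hp : IsProbabilityMeasure (ν.map fun x => x - c) :=
    Measure.isProbabilityMeasure_map (by fun_prop)
  obtain ⟨h1, h2⟩ := map_sub_integral hν
  refine le_trans ?_ (measure_exists_qThreshold_le hD h1 h2 hη (by linarith))
  rw [← Measure.infinitePi_map_pi (fun _ : ℕ => ν) (f := fun _ x => x - c)
    (fun _ => by fun_prop)]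
  refine le_trans (measure_mono ?_) (Measure.le_map_apply
    (by fun_prop : Measurable fun (X : ℕ → ℝ) i => X i - c).aemeasurable _)
  rintro X ⟨n, hnl, hn⟩
  rw [List.length_map, List.length_range] at hnl
  have hl : 1 < Real.log (1 / η) := by
    rw [Real.lt_log_iff_exp_lt (by positivity)]
    have : 4 ≤ 1 / η := by rw [le_div_iff₀ hη]; linarith
    linarith [Real.exp_one_lt_d9]
  have hn2 : 2 ≤ n := by
    have : (1 : ℝ) < n := hl.trans_le hnl
    exact_mod_cast this
  refine ⟨n, hn2, hnl, ?_⟩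
  change qThreshold D₁ (empVar ((List.range n).map fun i => X i - c)) η ≤ _
  rw [empVar_map_sub X c (by omega)]
  refine hn.trans (le_trans ?_ (le_abs_self _))
  simp only [sum_map_range, Finset.sum_sub_distrib, Finset.sum_const, Finset.card_range,
    nsmul_eq_mul]
  nlinarith [(Nat.cast_nonneg n : (0 : ℝ) ≤ n)]

end Shifted

/-! ### Grouping and thinning of independent families -/

/-- Functions of disjoint blocks of an independent family form an independent family. -/
lemma map_blocks_eq_infinitePi {Ω ι κ E F : Type*} [MeasurableSpace Ω] [MeasurableSpace E]
    [MeasurableSpace F] {μ : Measure Ω} [IsProbabilityMeasure μ] {f : ι → Ω → E}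
    (hf : ∀ i, Measurable (f i)) (hind : iIndepFun f μ) {e : ℕ × κ → ι}
    (he : Function.Injective e) {φ : (κ → E) → F} (hφ : Measurable φ) :
    μ.map (fun ω i => φ fun b => f (e (i, b)) ω) =
      Measure.infinitePi fun i : ℕ =>
        (Measure.infinitePi fun b => μ.map (f (e (i, b)))).map φ := by
  have hp : ∀ p, IsProbabilityMeasure (μ.map (f p)) :=
    fun p => Measure.isProbabilityMeasure_map (hf p).aemeasurable
  have h1 := iIndepFun.map_fun_eq_infinitePi_map (fun p => hf (e p)) (hind.precomp he)
  have h2 := Measure.infinitePi_map_curry fun (i : ℕ) (b : κ) => μ.map (f (e (i, b)))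
  rw [← Measure.infinitePi_map_pi _ fun _ => hφ, ← h2]
  erw [← h1]
  rw [Measure.map_map (by fun_prop) (by fun_prop), Measure.map_map (by fun_prop) (by fun_prop)]
  rfl

lemma infinitePi_bool_map {E F : Type*} [MeasurableSpace E] [MeasurableSpace F]
    (m : Bool → Measure E) [∀ b, IsProbabilityMeasure (m b)] {φ : E → E → F}
    (hφ : Measurable fun p : E × E => φ p.1 p.2) :
    (Measure.infinitePi m).map (fun g => φ (g true) (g false)) =
      ((m true).prod (m false)).map fun p => φ p.1 p.2 := by
  rw [← Measure.infinitePi_map_eval_prod (P := m) (i := true) (j := false) (by decide),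
    Measure.map_map hφ (by fun_prop)]
  rfl

/-- Applying a map to the pairs of coordinates of two independent i.i.d. sequences gives an i.i.d.
sequence. -/
lemma prod_infinitePi_map {E F : Type*} [MeasurableSpace E] [MeasurableSpace F]
    (α β : Measure E) [IsProbabilityMeasure α] [IsProbabilityMeasure β] {φ : E → E → F}
    (hφ : Measurable fun p : E × E => φ p.1 p.2) :
    ((Measure.infinitePi fun _ : ℕ => α).prod (Measure.infinitePi fun _ : ℕ => β)).map
      (fun p i => φ (p.1 i) (p.2 i)) =
      Measure.infinitePi fun _ : ℕ => (α.prod β).map fun p => φ p.1 p.2 := by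
  let m : Bool → Measure E := fun b => if b then α else β
  have hm : ∀ b, IsProbabilityMeasure (m b) := by
    intro b
    cases b <;> simp only [m] <;> infer_instance
  have h1 := Measure.infinitePi_map_curry fun (b : Bool) (_ : ℕ) => m b
  have h2 := Measure.infinitePi_map_eval_prod
    (P := fun b : Bool => Measure.infinitePi fun _ : ℕ => m b) (i := true) (j := false)
    (by decide)
  have hφ2 : Measurable fun (p : (ℕ → E) × (ℕ → E)) (i : ℕ) => φ (p.1 i) (p.2 i) :=
    measurable_pi_lambda _ fun i => hφ.comp (by fun_prop : Measurable
      fun p : (ℕ → E) × (ℕ → E) => (p.1 i, p.2 i))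
  have hφ3 : Measurable fun g : Bool → E => φ (g true) (g false) :=
    hφ.comp (by fun_prop : Measurable fun g : Bool → E => (g true, g false))
  have h3 := map_blocks_eq_infinitePi
    (μ := Measure.infinitePi fun p : Bool × ℕ => m p.1)
    (f := fun (p : Bool × ℕ) (x : Bool × ℕ → E) => x p) (fun p => measurable_pi_apply p)
    (iIndepFun_infinitePi (X := fun _ x => x) fun _ => measurable_id)
    (e := Prod.swap) Prod.swap_injective (φ := fun g => φ (g true) (g false)) hφ3
  simp only [Measure.infinitePi_map_eval, Prod.swap_prod_mk] at h3
  rw [infinitePi_bool_map m hφ] at h3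
  change ((Measure.infinitePi fun _ : ℕ => m true).prod
    (Measure.infinitePi fun _ : ℕ => m false)).map _ =
    Measure.infinitePi fun _ : ℕ => ((m true).prod (m false)).map _
  rw [← h3, ← h2, ← h1, Measure.map_map hφ2 (by fun_prop),
    Measure.map_map (hφ2.comp (by fun_prop)) (by fun_prop)]
  rfl

/-- The initial segments of a set of natural numbers are the initial segments of an injective
sequence. -/
lemma exists_injective_filter_range (A : ℕ → Bool) :
    ∃ e : ℕ → ℕ, Function.Injective e ∧
      ∀ n, ∃ m, (List.range n).filter A = (List.range m).map e := by
  classical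
  -- an infinite set that agrees with `A` up to the last element of `A`, if there is one
  let p : ℕ → Prop := fun i => A i ∨ ∀ j ≥ i, A j = false
  have hp : {i | p i}.Infinite := by
    by_cases h : {i | A i = true}.Infinite
    · exact h.mono fun i hi => Or.inl hi
    · obtain ⟨N, hN⟩ := (Set.not_infinite.1 h).bddAbove
      refine Set.infinite_of_forall_exists_gt fun a =>
        ⟨max a N + 1, Or.inr fun j hj => ?_, by omega⟩
      by_contra hA
      have := hN (show j ∈ {i | A i = true} by simpa using hA)
      omega
  refine ⟨Nat.nth p, Nat.nth_injective hp, fun n => ?_⟩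
  have hcount : ∀ n, (List.range n).filter (fun i => decide (p i)) =
      (List.range (Nat.count p n)).map (Nat.nth p) := by
    intro n
    induction n with
    | zero => simp
    | succ n ih =>
      rw [List.range_succ, List.filter_append, ih, Nat.count_succ]
      by_cases h : p n
      · simp [h, List.range_succ, Nat.nth_count]
      · simp [h]
  induction n with
  | zero => exact ⟨0, rfl⟩
  | succ n ih =>
    by_cases h : ∀ i ≤ n, p i → A i = true
    · refine ⟨Nat.count p (n + 1), ?_⟩
      rw [← hcount]
      refine List.filter_congr fun i hi => ?_
      rw [List.mem_range] at hi
      have := h i (by omega)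
      rw [Bool.eq_iff_iff, decide_eq_true_iff]
      exact ⟨Or.inl, this⟩
    · push Not at h
      obtain ⟨i, hi, hpi, hAi⟩ := h
      have hn : A n = false := (hpi.resolve_left hAi) n hi
      obtain ⟨m, hm⟩ := ih
      refine ⟨m, ?_⟩
      rw [List.range_succ, List.filter_append, hm]
      simp [hn]

/-- Any property of the first `n` entries of a discrete-valued sequence is measurable. -/
lemma measurableSet_map_range_mem {E : Type*} [MeasurableSpace E] [Countable E]
    [MeasurableSingletonClass E] {Ω : Type*} {mΩ : MeasurableSpace Ω} {f : ℕ → Ω → E}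
    (hf : ∀ i, Measurable (f i)) (n : ℕ) (S : Set (List E)) :
    MeasurableSet {ω | (List.range n).map (fun i => f i ω) ∈ S} := by
  have h : Measurable fun (ω : Ω) (i : Fin n) => f i ω := measurable_pi_lambda _ fun i => hf i
  have h2 : {ω | (List.range n).map (fun i => f i ω) ∈ S} =
      (fun (ω : Ω) (i : Fin n) => f i ω) ⁻¹' {g | List.ofFn g ∈ S} := by
    ext ω
    simp only [Set.mem_ofPred_eq, Set.mem_preimage]
    have h3 : (List.range n).map (fun i => f i ω) = List.ofFn fun i : Fin n => f i ω :=
      List.ext_getElem (by simp) (by simp)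
    rw [h3]
  rw [h2]
  exact h (Set.to_countable _).measurableSet

/-- Thinning an i.i.d. sequence by an independent random set of indices does not raise the
probability that a prefix ever lies in a given set: conditionally on the set of indices, the
remaining entries are again i.i.d. -/
lemma measure_exists_thinned_le {E : Type*} [MeasurableSpace E] [Countable E]
    [MeasurableSingletonClass E] (α : Measure Bool) [IsProbabilityMeasure α] (β : Measure E)
    [IsProbabilityMeasure β] (S : Set (List E)) {c : ENNReal}
    (h : Measure.infinitePi (fun _ : ℕ => β) {Z | ∃ n, (List.range n).map Z ∈ S} ≤ c) :
    ((Measure.infinitePi fun _ : ℕ => α).prod (Measure.infinitePi fun _ : ℕ => β))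
      {p | ∃ n, ((List.range n).filter p.1).map p.2 ∈ S} ≤ c := by
  have hmS : MeasurableSet {Z : ℕ → E | ∃ n, (List.range n).map Z ∈ S} := by
    simp only [Set.ofPred_exists]
    exact MeasurableSet.iUnion fun n =>
      measurableSet_map_range_mem (fun i => measurable_pi_apply i) n S
  have hm : MeasurableSet {p : (ℕ → Bool) × (ℕ → E) |
      ∃ n, ((List.range n).filter p.1).map p.2 ∈ S} := by
    simp only [Set.ofPred_exists]
    refine MeasurableSet.iUnion fun n => ?_
    have h := measurableSet_map_range_mem
      (f := fun (i : ℕ) (p : (ℕ → Bool) × (ℕ → E)) => (p.1 i, p.2 i)) (fun i => by fun_prop) n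
      {L | (L.filter Prod.fst).map Prod.snd ∈ S}
    convert! h using 4
    simp [List.filter_map, Function.comp_def]
  rw [Measure.prod_apply hm]
  calc _ ≤ ∫⁻ _, c ∂(Measure.infinitePi fun _ : ℕ => α) := by
        refine lintegral_mono fun A => ?_
        obtain ⟨e, he, heq⟩ := exists_injective_filter_range A
        have hval : Measure.infinitePi (fun _ : ℕ => β)
            ((fun Z i => Z (e i)) ⁻¹' {Z : ℕ → E | ∃ n, (List.range n).map Z ∈ S}) =
            Measure.infinitePi (fun _ : ℕ => β) {Z | ∃ n, (List.range n).map Z ∈ S} := by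
          rw [← Measure.map_apply (by fun_prop) hmS,
            Measure.map_infinitePi_infinitePi_of_inj (P := fun _ : ℕ => β) he]
        refine (measure_mono ?_).trans (hval.trans_le h)
        rintro Z ⟨n, hn⟩
        obtain ⟨m, hm⟩ := heq n
        refine ⟨m, ?_⟩
        simp only [hm, List.map_map] at hn
        exact hn
    _ = c := by simp

/-! ### The tests on the responses of the labeler -/

instance : Finite Response :=
  Finite.of_injective (fun y : Response => match y with
    | Response.zero => (0 : Fin 3)
    | Response.one => 1
    | Response.abstain => 2) fun a b h => by cases a <;> cases b <;> simp_all

/-- The contribution of a response to the array of labels, where the label `c` is written as `1`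
and the other label as `-1`. -/
def signedLabel (c y : Response) : Option ℝ :=
  if y = Response.abstain then none else if y = c then some 1 else some (-1)

lemma arrayB_eq_filterMap (X : List Response) :
    arrayB X = X.filterMap (signedLabel Response.one) := by
  refine List.filterMap_congr fun y _ => ?_
  cases y <;> simp [signedLabel]

lemma neg_arrayB_eq_filterMap (X : List Response) :
    (arrayB X).map (fun b => -b) = X.filterMap (signedLabel Response.zero) := by
  rw [arrayB, List.map_filterMap]
  refine List.filterMap_congr fun y _ => ?_
  cases y <;> simp [signedLabel]

/-- The indicator of the event that a label was received. -/
def received : Response → ℝ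
  | Response.abstain => 0
  | Response.zero => 1
  | Response.one => 1

lemma arrayA_eq_map (X : List Response) : arrayA X = X.map received :=
  List.map_congr_left fun y _ => by cases y <;> rfl

section LabelTest

variable (q : Measure Response)

/-- The conditional law, given that a label is received, of the event that this label is `c`. If no
label is ever received, the law is that of an event which does not occur. -/
noncomputable def labelLaw (c : Response) : Measure Bool :=
  open Classical in
  if q {y | y ≠ Response.abstain} = 0 then Measure.dirac false
  else (q[|{y | y ≠ Response.abstain}]).map fun y => decide (y = c)

lemma labelLaw_true_le {c : Response} (hq : (q[|{y | y ≠ Response.abstain}]) {c} ≤ 1 / 2) :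
    labelLaw q c {true} ≤ 1 / 2 := by
  unfold labelLaw
  split_ifs with h
  · simp
  · rw [Measure.map_apply (measurable_of_countable _) (measurableSet_singleton _)]
    refine le_of_eq_of_le ?_ hq
    congr 1
    ext y
    simp

variable [IsProbabilityMeasure q]

instance (c : Response) : IsProbabilityMeasure (labelLaw q c) := by
  unfold labelLaw
  split_ifs with h
  · infer_instance
  · have := cond_isProbabilityMeasure h
    exact Measure.isProbabilityMeasure_map (measurable_of_countable _).aemeasurable

lemma mul_labelLaw (c : Response) (b : Bool) :
    q {y | y ≠ Response.abstain} * labelLaw q c {b} =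
      q ({y | y ≠ Response.abstain} ∩ {y | decide (y = c) = b}) := by
  unfold labelLaw
  split_ifs with h
  · rw [h, zero_mul]
    exact (measure_mono_null Set.inter_subset_left h).symm
  · rw [Measure.map_apply (measurable_of_countable _) (measurableSet_singleton _), mul_comm]
    exact cond_mul_eq_inter (Set.to_countable _).measurableSet _ q

/-- The response composed of the two independent choices whether to answer and which label to
give. -/
def composeResponse (c c' : Response) (a z : Bool) : Response :=
  if a then if z then c else c' else Response.abstain

lemma map_composeResponse {c c' : Response} (hc : c ≠ Response.abstain)
    (hc' : c' ≠ Response.abstain) (hcc : c ≠ c') :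
    ((q.map fun y => decide (y ≠ Response.abstain)).prod (labelLaw q c)).map
      (fun p => composeResponse c c' p.1 p.2) = q := by
  have hα : ∀ b, (q.map fun y => decide (y ≠ Response.abstain)) {b} =
      q {y | decide (y ≠ Response.abstain) = b} := fun b =>
    Measure.map_apply (measurable_of_countable _) (measurableSet_singleton _)
  have hpr : IsProbabilityMeasure (q.map fun y => decide (y ≠ Response.abstain)) :=
    Measure.isProbabilityMeasure_map (measurable_of_countable _).aemeasurable
  have hlabel : ∀ b, ((q.map fun y => decide (y ≠ Response.abstain)).prod (labelLaw q c))
      ({true} ×ˢ {b}) = q ({y | y ≠ Response.abstain} ∩ {y | decide (y = c) = b}) := by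
    intro b
    rw [Measure.prod_prod, hα, ← mul_labelLaw]
    simp
  refine Measure.ext_of_singleton fun y => ?_
  rw [Measure.map_apply (measurable_of_countable _) (measurableSet_singleton _)]
  by_cases h0 : y = Response.abstain
  · subst h0
    have : (fun p : Bool × Bool => composeResponse c c' p.1 p.2) ⁻¹' {Response.abstain} =
        {false} ×ˢ Set.univ := by
      ext ⟨a, z⟩
      cases a <;> cases z <;> simp [composeResponse, hc, hc']
    rw [this, Measure.prod_prod, hα, measure_univ, mul_one]
    congr 1
    ext y
    simp
  by_cases h1 : y = c
  · subst h1
    have : (fun p : Bool × Bool => composeResponse y c' p.1 p.2) ⁻¹' {y} = {true} ×ˢ {true} := by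
      ext ⟨a, z⟩
      cases a <;> cases z <;> simp [composeResponse, hc.symm, hcc.symm]
    rw [this, hlabel]
    congr 1
    ext z
    simp only [Set.mem_inter_iff, Set.mem_ofPred_eq, decide_eq_true_iff, Set.mem_singleton_iff]
    exact ⟨fun h => h.2, fun h => ⟨h ▸ hc, h⟩⟩
  · have h2 : y = c' := by cases y <;> cases c <;> cases c' <;> simp_all
    subst h2
    have : (fun p : Bool × Bool => composeResponse c y p.1 p.2) ⁻¹' {y} = {true} ×ˢ {false} := by
      ext ⟨a, z⟩
      cases a <;> cases z <;> simp [composeResponse, hc'.symm, hcc]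
    rw [this, hlabel]
    congr 1
    ext z
    simp only [Set.mem_inter_iff, Set.mem_ofPred_eq, decide_eq_false_iff_not,
      Set.mem_singleton_iff]
    refine ⟨fun h => ?_, fun h => h ▸ ⟨hc', h1⟩⟩
    cases z <;> cases y <;> cases c <;> simp_all

lemma filterMap_composeResponse {c c' : Response} (hc : c ≠ Response.abstain)
    (hc' : c' ≠ Response.abstain) (hcc : c ≠ c') (A Z : ℕ → Bool) (L : List ℕ) :
    (L.map fun i => composeResponse c c' (A i) (Z i)).filterMap (signedLabel c) =
      ((L.filter A).map Z).map fun z => if z then 1 else -1 := by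
  induction L with
  | nil => rfl
  | cons i L ih =>
    cases hA : A i <;> cases hZ : Z i <;>
      simp [composeResponse, signedLabel, hA, hZ, hc, hc', hcc.symm] at ih ⊢ <;> exact ih

/-- If `c` is not the more likely label, then the test for an excess of labels `c` is unlikely ever
to succeed. The number of labels is random, but the labels received are i.i.d. whichever queries
they answer. -/
lemma measure_exists_checkSignificant_label_le {D₀ : ℝ} (hD : IsMeanConstant D₀) {c c' : Response}
    (hc : c ≠ Response.abstain) (hc' : c' ≠ Response.abstain) (hcc : c ≠ c')
    (hq : (q[|{y | y ≠ Response.abstain}]) {c} ≤ 1 / 2) {η : ℝ} (hη : 0 < η) (hη1 : η < 1) :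
    Measure.infinitePi (fun _ : ℕ => q) {Y | ∃ n : ℕ, CheckSignificant D₀
      (((List.range n).map Y).filterMap (signedLabel c)) η} ≤ ENNReal.ofReal η := by
  set sgn : Bool → ℝ := fun z => if z then 1 else -1 with hsgn
  have hsgnm : Measurable sgn := measurable_of_countable _
  have hα : IsProbabilityMeasure (q.map fun y => decide (y ≠ Response.abstain)) :=
    Measure.isProbabilityMeasure_map (measurable_of_countable _).aemeasurable
  have hν : IsProbabilityMeasure ((labelLaw q c).map sgn) :=
    Measure.isProbabilityMeasure_map hsgnm.aemeasurable
  have h1 : Measure.infinitePi (fun _ : ℕ => labelLaw q c)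
      {Z | ∃ n, (List.range n).map Z ∈ {L | CheckSignificant D₀ (L.map sgn) η}} ≤
      ENNReal.ofReal η := by
    have hb : ∀ᵐ x ∂((labelLaw q c).map sgn), x ∈ Set.Icc (-1 : ℝ) 1 := by
      refine (ae_map_iff (p := fun x => x ∈ Set.Icc (-1 : ℝ) 1) hsgnm.aemeasurable
        measurableSet_Icc).2 (Filter.Eventually.of_forall fun z => ?_)
      cases z <;> simp [hsgn]
    have hmean : ∫ x, x ∂((labelLaw q c).map sgn) ≤ 0 := by
      rw [integral_map hsgnm.aemeasurable (by fun_prop), integral_fintype (Integrable.of_finite)]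
      have ht : (labelLaw q c).real {true} ≤ 1 / 2 := by
        rw [Measure.real]
        exact (ENNReal.toReal_mono (by simp) (labelLaw_true_le q hq)).trans (by simp)
      have hf : (labelLaw q c).real {false} = 1 - (labelLaw q c).real {true} := by
        rw [← probReal_compl_eq_one_sub (measurableSet_singleton _)]
        congr 1
        ext z
        cases z <;> simp
      simp only [Fintype.univ_bool, smul_eq_mul, hsgn]
      rw [Finset.sum_pair (by decide), hf]
      simp only [if_true, Bool.false_eq_true, if_false]
      linarith
    refine le_trans ?_ (measure_exists_checkSignificant_le hD hb hmean hη hη1)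
    rw [← Measure.infinitePi_map_pi (fun _ : ℕ => labelLaw q c) fun _ => hsgnm]
    refine le_trans (measure_mono ?_) (Measure.le_map_apply
      (by fun_prop : Measurable fun (Z : ℕ → Bool) i => sgn (Z i)).aemeasurable _)
    rintro Z ⟨n, hn⟩
    refine ⟨n, ?_⟩
    simpa [List.map_map, Function.comp_def] using hn
  have h2 := measure_exists_thinned_le (q.map fun y => decide (y ≠ Response.abstain))
    (labelLaw q c) _ h1
  have hφ : Measurable fun p : Bool × Bool => composeResponse c c' p.1 p.2 :=
    measurable_of_countable _
  have h3 := prod_infinitePi_map (q.map fun y => decide (y ≠ Response.abstain))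
    (labelLaw q c) hφ
  rw [map_composeResponse q hc hc' hcc] at h3
  rw [← h3]
  have hm : MeasurableSet {Y : ℕ → Response | ∃ n : ℕ, CheckSignificant D₀
      (((List.range n).map Y).filterMap (signedLabel c)) η} := by
    simp only [Set.ofPred_exists]
    exact MeasurableSet.iUnion fun n => measurableSet_map_range_mem
      (fun i => measurable_pi_apply i) n
      {L | CheckSignificant D₀ (L.filterMap (signedLabel c)) η}
  have hφ2 : Measurable fun (p : (ℕ → Bool) × (ℕ → Bool)) (i : ℕ) =>
      composeResponse c c' (p.1 i) (p.2 i) :=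
    measurable_pi_lambda _ fun i => hφ.comp (by fun_prop : Measurable
      fun p : (ℕ → Bool) × (ℕ → Bool) => (p.1 i, p.2 i))
  rw [Measure.map_apply hφ2 hm]
  refine le_trans (measure_mono ?_) h2
  rintro ⟨A, Z⟩ ⟨n, hn⟩
  refine ⟨n, ?_⟩
  rw [filterMap_composeResponse hc hc' hcc] at hn
  exact hn

end LabelTest

section Family

variable {Ω : Type*} [MeasurableSpace Ω] {μ : Measure Ω}
  {P : ℝ → PMF Response} {Y : ℕ → ℕ → ℝ → Ω → Response}

/-- If the labels received at `x` are not more often `c` than the other label, then the test for an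
excess of labels `c` is unlikely ever to succeed. -/
lemma measure_labelTest_le (hY : IsResponseFamily μ P Y) {D₀ : ℝ} (hD : IsMeanConstant D₀)
    {c c' : Response} (hc : c ≠ Response.abstain) (hc' : c' ≠ Response.abstain) (hcc : c ≠ c')
    (k : ℕ) (x : ℝ) (hq : ((P x).toMeasure[|{y | y ≠ Response.abstain}]) {c} ≤ 1 / 2) {η : ℝ}
    (hη : 0 < η) (hη1 : η < 1) :
    μ {ω | ∃ n : ℕ, CheckSignificant D₀
      (((List.range n).map fun i => Y k i x ω).filterMap (signedLabel c)) η} ≤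
      ENNReal.ofReal η := by
  refine le_trans ?_ (measure_exists_checkSignificant_label_le _ hD hc hc' hcc hq hη hη1)
  have hind := hY.indep.precomp (g := fun i : ℕ => (k, i, x)) fun i j h => by simpa using h
  have h := iIndepFun.map_fun_eq_infinitePi_map (fun i => hY.measurable k i x) hind
  simp only [hY.law] at h
  rw [← h]
  exact Measure.le_map_apply
    (measurable_pi_lambda _ fun i => hY.measurable k i x).aemeasurable _

lemma integral_received (p : PMF Response) :
    ∫ y, received y ∂p.toMeasure = 1 - (p Response.abstain).toReal := by
  have h : ∀ y, received y = 1 - Set.indicator {Response.abstain} 1 y := by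
    intro y
    cases y <;> simp [received]
  simp only [h]
  rw [integral_sub Integrable.of_finite Integrable.of_finite,
    integral_indicator_one (measurableSet_singleton _), Measure.real,
    PMF.toMeasure_apply_singleton _ _ (measurableSet_singleton _)]
  simp

/-- If receiving a label is not more likely at `x` than at `m`, then the test for an excess
of labels at `x` over those at `m` is unlikely ever to succeed. -/
lemma measure_abstentionTest_le [IsProbabilityMeasure μ] (hY : IsResponseFamily μ P Y)
    {D₁ : ℝ} (hD : IsVarConstant D₁) (k : ℕ) {x m : ℝ} (hxm : x ≠ m)
    (hP : P m Response.abstain ≤ P x Response.abstain) {η : ℝ} (hη : 0 < η) (hη1 : η ≤ 1 / 4) :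
    μ {ω | ∃ n : ℕ, CheckSignificantVar D₁ (List.zipWith (fun a b => a - b)
      (arrayA ((List.range n).map fun i => Y k i x ω))
      (arrayA ((List.range n).map fun i => Y k i m ω))) η} ≤ ENNReal.ofReal η := by
  set pt : Bool → ℝ := fun b => if b then x else m with hpt
  set φ : (Bool → Response) → ℝ := fun g => received (g true) - received (g false) with hφ
  have hφm : Measurable φ := measurable_of_countable _
  have he : Function.Injective fun p : ℕ × Bool => (k, p.1, pt p.2) := by
    rintro ⟨i, b⟩ ⟨j, b'⟩ h
    cases b <;> cases b' <;> simp_all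
  have h := map_blocks_eq_infinitePi (f := fun j : ℕ × ℕ × ℝ => Y j.1 j.2.1 j.2.2)
    (fun j => hY.measurable _ _ _) hY.indep he hφm
  simp only [hY.law] at h
  set ν := (Measure.infinitePi fun b => (P (pt b)).toMeasure).map φ with hν
  have hνp : IsProbabilityMeasure ν := Measure.isProbabilityMeasure_map hφm.aemeasurable
  have hr : ∀ y, received y ∈ Set.Icc (0 : ℝ) 1 := by
    intro y
    cases y <;> simp [received]
  have hb : ∀ᵐ t ∂ν, t ∈ Set.Icc (-1 : ℝ) 1 := by
    refine (ae_map_iff (p := fun t => t ∈ Set.Icc (-1 : ℝ) 1) hφm.aemeasurable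
      measurableSet_Icc).2 (Filter.Eventually.of_forall fun g => ?_)
    have h1 := hr (g true)
    have h2 := hr (g false)
    constructor <;> simp only [hφ] <;> linarith [h1.1, h1.2, h2.1, h2.2]
  have hmean : ∫ t, t ∂ν ≤ 0 := by
    have hb (b : Bool) : ∫ g, received (g b) ∂(Measure.infinitePi fun b => (P (pt b)).toMeasure) =
        1 - (P (pt b) Response.abstain).toReal := by
      rw [← integral_received]
      have h3 := (measurePreserving_eval_infinitePi (fun b => (P (pt b)).toMeasure) b).map_eq
      rw [← h3, integral_map (measurable_pi_apply b).aemeasurable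
        (measurable_of_countable _).aestronglyMeasurable]
    rw [hν, integral_map hφm.aemeasurable (by fun_prop)]
    simp only [hφ]
    rw [integral_sub Integrable.of_finite Integrable.of_finite, hb, hb]
    have := ENNReal.toReal_mono (PMF.apply_ne_top (P x) _) hP
    simp only [hpt, if_true, Bool.false_eq_true, if_false]
    linarith
  refine le_trans ?_ (measure_exists_checkSignificantVar_le hD hb hmean hη hη1)
  rw [← h]
  refine le_trans (measure_mono ?_) (Measure.le_map_apply (measurable_pi_lambda _ fun i =>
    hφm.comp (measurable_pi_lambda _ fun b => hY.measurable _ _ _)).aemeasurable _)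
  rintro ω ⟨n, hn⟩
  refine ⟨n, ?_⟩
  rw [arrayA_eq_map, arrayA_eq_map, List.map_map, List.map_map, List.zipWith_map,
    List.zipWith_self] at hn
  simpa [hφ, hpt] using hn

end Family

/-! ### The intervals of the algorithm -/

section Deterministic

variable {D₀ D₁ η : ℝ}

lemma tests_eq_some {I J : ℝ × ℝ} {Xu Xm Xv : List Response}
    (h : tests D₀ D₁ η I Xu Xm Xv = some J) :
    (J = (ptU I, I.2) ∧
      (CheckSignificantVar D₁ (List.zipWith (fun a b => a - b) (arrayA Xu) (arrayA Xm)) η ∨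
        CheckSignificant D₀ (Xu.filterMap (signedLabel Response.zero)) η)) ∨
    (J = (I.1, ptV I) ∧
      (CheckSignificantVar D₁ (List.zipWith (fun a b => a - b) (arrayA Xv) (arrayA Xm)) η ∨
        CheckSignificant D₀ (Xv.filterMap (signedLabel Response.one)) η)) := by
  rw [← neg_arrayB_eq_filterMap, ← arrayB_eq_filterMap]
  unfold tests at h
  split_ifs at h with h1 h2 h3 h4
  · exact Or.inl ⟨(Option.some.inj h).symm, Or.inl h1⟩
  · exact Or.inr ⟨(Option.some.inj h).symm, Or.inl h2⟩
  · exact Or.inl ⟨(Option.some.inj h).symm, Or.inr h3⟩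
  · exact Or.inr ⟨(Option.some.inj h).symm, Or.inr h4⟩

lemma innerLoop_eq_some_iff {y : ℕ → ℝ → Response} {I J : ℝ × ℝ} :
    innerLoop D₀ D₁ η y I = some J ↔ ∃ n, 1 ≤ n ∧ iterationResult D₀ D₁ η y I n = some J ∧
      ∀ m, 1 ≤ m → m < n → iterationResult D₀ D₁ η y I m = none := by
  classical
  unfold innerLoop
  constructor
  · intro h
    split_ifs at h with h1
    refine ⟨_, (Nat.find_spec h1).1, h, fun m hm hmn => ?_⟩
    by_contra hne
    exact Nat.find_min h1 hmn ⟨hm, hne⟩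
  · rintro ⟨n, hn, hJ, hmin⟩
    have h1 : ∃ n : ℕ, 1 ≤ n ∧ iterationResult D₀ D₁ η y I n ≠ none := ⟨n, hn, by simp [hJ]⟩
    have hfind : Nat.find h1 = n := by
      rw [Nat.find_eq_iff]
      exact ⟨⟨hn, by simp [hJ]⟩, fun m hm h => h.2 (hmin m h.1 hm)⟩
    rw [dif_pos h1, hfind, hJ]

lemma innerLoop_mem {y : ℕ → ℝ → Response} {I J : ℝ × ℝ}
    (h : innerLoop D₀ D₁ η y I = some J) : J = (ptU I, I.2) ∨ J = (I.1, ptV I) := by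
  obtain ⟨n, _, hn, _⟩ := innerLoop_eq_some_iff.1 h
  exact (tests_eq_some hn).imp And.left And.left

open Classical in
/-- The finitely many values that the interval `[L_k, R_k]` can take. -/
noncomputable def reachable : ℕ → Finset (ℝ × ℝ)
  | 0 => {(0, 1)}
  | k + 1 => (reachable k).image (fun I => (ptU I, I.2)) ∪
      (reachable k).image (fun I => (I.1, ptV I))

lemma interval_mem_reachable {y : ℕ → ℕ → ℝ → Response} {k : ℕ} {I : ℝ × ℝ}
    (h : interval D₀ D₁ η y k = some I) : I ∈ reachable k := by
  induction k generalizing I with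
  | zero => simpa [interval, reachable, eq_comm] using h
  | succ k ih =>
    rw [interval, Option.bind_eq_some_iff] at h
    obtain ⟨J, hJ, hI⟩ := h
    simp only [reachable, Finset.mem_union, Finset.mem_image]
    exact (innerLoop_mem hI).imp (fun h => ⟨J, ih hJ, h.symm⟩) (fun h => ⟨J, ih hJ, h.symm⟩)

lemma reachable_bounds {k : ℕ} {I : ℝ × ℝ} (h : I ∈ reachable k) :
    0 ≤ I.1 ∧ I.2 ≤ 1 ∧ I.2 - I.1 = (3 / 4) ^ k := by
  induction k generalizing I with
  | zero =>
    rw [reachable, Finset.mem_singleton] at h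
    subst h
    norm_num
  | succ k ih =>
    simp only [reachable, Finset.mem_union, Finset.mem_image] at h
    rw [pow_succ]
    have hk : (0 : ℝ) < (3 / 4) ^ k := by positivity
    rcases h with ⟨J, hJ, rfl⟩ | ⟨J, hJ, rfl⟩ <;> obtain ⟨h1, h2, h3⟩ := ih hJ <;>
      refine ⟨?_, ?_, ?_⟩ <;> simp only [ptU, ptV] <;> linarith

end Deterministic

/-! ### Measurability -/

section Measurability

variable {D₀ D₁ η : ℝ} {Ω : Type*} {mΩ : MeasurableSpace Ω}

lemma measurableSet_iterationResult_eq {y : ℕ → ℝ → Ω → Response}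
    (hy : ∀ i x, Measurable (y i x)) (I : ℝ × ℝ) (n : ℕ) (o : Option (ℝ × ℝ)) :
    MeasurableSet {ω | iterationResult D₀ D₁ η (fun i x => y i x ω) I n = o} := by
  have h := measurableSet_map_range_mem
    (f := fun i ω => (y i (ptU I) ω, y i (ptM I) ω, y i (ptV I) ω))
    (fun i => (hy i _).prodMk ((hy i _).prodMk (hy i _))) n
    {L | tests D₀ D₁ η I (L.map fun t => t.1) (L.map fun t => t.2.1) (L.map fun t => t.2.2) = o}
  simp only [Set.mem_ofPred_eq, List.map_map] at h
  exact h

lemma measurableSet_innerLoop_eq {y : ℕ → ℝ → Ω → Response}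
    (hy : ∀ i x, Measurable (y i x)) (I J : ℝ × ℝ) :
    MeasurableSet {ω | innerLoop D₀ D₁ η (fun i x => y i x ω) I = some J} := by
  simp only [innerLoop_eq_some_iff, Set.ofPred_exists, Set.ofPred_and, Set.ofPred_forall]
  refine .iUnion fun n => .inter (.const _) (.inter (measurableSet_iterationResult_eq hy I n _) ?_)
  exact .iInter fun m => .iInter fun _ => .iInter fun _ =>
    measurableSet_iterationResult_eq hy I m none

lemma measurableSet_interval_eq {y : ℕ → ℕ → ℝ → Ω → Response} {k : ℕ}
    (hy : ∀ j < k, ∀ i x, Measurable (y j i x)) (I : ℝ × ℝ) :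
    MeasurableSet {ω | interval D₀ D₁ η (fun j i x => y j i x ω) k = some I} := by
  induction k generalizing I with
  | zero => exact .const (some ((0 : ℝ), (1 : ℝ)) = some I)
  | succ k ih =>
    have h : {ω | interval D₀ D₁ η (fun j i x => y j i x ω) (k + 1) = some I} =
        ⋃ J ∈ reachable k, {ω | interval D₀ D₁ η (fun j i x => y j i x ω) k = some J} ∩
          {ω | innerLoop D₀ D₁ η (fun i x => y k i x ω) J = some I} := by
      ext ω
      simp only [interval, Option.bind_eq_some_iff, Set.mem_ofPred_eq, Set.mem_iUnion,
        Set.mem_inter_iff, exists_prop]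
      exact ⟨fun ⟨J, h1, h2⟩ => ⟨J, interval_mem_reachable h1, h1, h2⟩,
        fun ⟨J, _, h1, h2⟩ => ⟨J, h1, h2⟩⟩
    rw [h]
    refine Finset.measurableSet_biUnion _ fun J _ => ?_
    exact (ih (fun j hj => hy j (by omega)) J).inter
      (measurableSet_innerLoop_eq (hy k (by omega)) J I)

end Measurability

/-! ### The failure probability -/

section Failure

variable {D₀ D₁ η θ : ℝ}

/-- The event that the `k`-th pass of the outer loop, when started from the interval `I`, discards
the threshold. -/
def passFailure {Ω : Type*} (D₀ D₁ η θ : ℝ) (Y : ℕ → ℕ → ℝ → Ω → Response) (k : ℕ) (I : ℝ × ℝ) :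
    Set Ω :=
  {ω | ∃ J, innerLoop D₀ D₁ η (fun i x => Y k i x ω) I = some J ∧ θ ∉ Set.Icc J.1 J.2}

lemma measurableSet_passFailure {Ω : Type*} {mΩ : MeasurableSpace Ω}
    {Y : ℕ → ℕ → ℝ → Ω → Response} {k : ℕ} (hY : ∀ i x, Measurable (Y k i x)) (I : ℝ × ℝ) :
    MeasurableSet (passFailure D₀ D₁ η θ Y k I) := by
  have h : passFailure D₀ D₁ η θ Y k I =
      ({ω | innerLoop D₀ D₁ η (fun i x => Y k i x ω) I = some (ptU I, I.2)} ∩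
        {_ω | θ ∉ Set.Icc (ptU I) I.2}) ∪
      ({ω | innerLoop D₀ D₁ η (fun i x => Y k i x ω) I = some (I.1, ptV I)} ∩
        {_ω | θ ∉ Set.Icc I.1 (ptV I)}) := by
    ext ω
    constructor
    · rintro ⟨J, hJ, hθ⟩
      rcases innerLoop_mem hJ with rfl | rfl
      · exact Or.inl ⟨hJ, hθ⟩
      · exact Or.inr ⟨hJ, hθ⟩
    · rintro (⟨hJ, hθ⟩ | ⟨hJ, hθ⟩)
      · exact ⟨_, hJ, hθ⟩
      · exact ⟨_, hJ, hθ⟩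
  rw [h]
  exact ((measurableSet_innerLoop_eq hY I _).inter (.const _)).union
    ((measurableSet_innerLoop_eq hY I _).inter (.const _))

variable {Ω : Type*} [MeasurableSpace Ω] {μ : Measure Ω}
  {P : ℝ → PMF Response} {Y : ℕ → ℕ → ℝ → Ω → Response}

/-- Only two of the four tests can discard the threshold: those at the quartile which lies strictly
between the threshold and the midpoint. -/
lemma measure_passFailure_le [IsProbabilityMeasure μ] (hD₀ : IsMeanConstant D₀)
    (hD₁ : IsVarConstant D₁) (hP : LabelerCondition P θ) (hY : IsResponseFamily μ P Y) (hη : 0 < η)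
    (hη1 : η ≤ 1 / 4) (k : ℕ) {I : ℝ × ℝ} (h0 : 0 ≤ I.1) (h1 : I.2 ≤ 1) (hI : I.1 < I.2)
    (hθ : θ ∈ Set.Icc I.1 I.2) :
    μ (passFailure D₀ D₁ η θ Y k I) ≤ ENNReal.ofReal (2 * η) := by
  have hM : ptM I ∈ Set.Icc (0 : ℝ) 1 := by constructor <;> simp only [ptM] <;> linarith
  have hU : ptU I ∈ Set.Icc (0 : ℝ) 1 := by constructor <;> simp only [ptU] <;> linarith
  have hV : ptV I ∈ Set.Icc (0 : ℝ) 1 := by constructor <;> simp only [ptV] <;> linarith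
  have hUM : ptU I < ptM I := by simp only [ptU, ptM]; linarith
  have hMV : ptM I < ptV I := by simp only [ptV, ptM]; linarith
  rw [two_mul, ENNReal.ofReal_add hη.le hη.le]
  rcases lt_or_ge θ (ptU I) with hlt | hge
  · have hA : P (ptM I) Response.abstain ≤ P (ptU I) Response.abstain := by
      refine hP.abstention _ hM _ hU ?_
      rw [abs_of_pos, abs_of_pos] <;> linarith
    have hB : ((P (ptU I)).toMeasure[|{y | y ≠ Response.abstain}]) {Response.zero} ≤ 1 / 2 := by
      refine (measure_mono ?_).trans (hP.noise _ hU)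
      rintro y rfl
      simp [trueLabel, hlt]
    refine le_trans (measure_mono ?_) ((measure_union_le _ _).trans (add_le_add
      (measure_abstentionTest_le hY hD₁ k hUM.ne hA hη hη1)
      (measure_labelTest_le hY hD₀ (c' := Response.one) (by decide) (by decide) (by decide) k _ hB
        hη (by linarith))))
    rintro ω ⟨J, hJ, hθJ⟩
    obtain ⟨n, _, hn, _⟩ := innerLoop_eq_some_iff.1 hJ
    rcases tests_eq_some hn with ⟨_, h | h⟩ | ⟨rfl, _⟩
    · exact Or.inl ⟨n, h⟩
    · exact Or.inr ⟨n, h⟩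
    · exact absurd ⟨hθ.1, by linarith⟩ hθJ
  rcases lt_or_ge (ptV I) θ with hlt | hle
  · have hA : P (ptM I) Response.abstain ≤ P (ptV I) Response.abstain := by
      refine hP.abstention _ hM _ hV ?_
      rw [abs_of_neg, abs_of_neg] <;> linarith
    have hB : ((P (ptV I)).toMeasure[|{y | y ≠ Response.abstain}]) {Response.one} ≤ 1 / 2 := by
      refine (measure_mono ?_).trans (hP.noise _ hV)
      rintro y rfl
      simp [trueLabel, hlt.le]
    refine le_trans (measure_mono ?_) ((measure_union_le _ _).trans (add_le_add
      (measure_abstentionTest_le hY hD₁ k hMV.ne' hA hη hη1)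
      (measure_labelTest_le hY hD₀ (c' := Response.zero) (by decide) (by decide) (by decide) k _ hB
        hη (by linarith))))
    rintro ω ⟨J, hJ, hθJ⟩
    obtain ⟨n, _, hn, _⟩ := innerLoop_eq_some_iff.1 hJ
    rcases tests_eq_some hn with ⟨rfl, _⟩ | ⟨_, h | h⟩
    · exact absurd ⟨by linarith, hθ.2⟩ hθJ
    · exact Or.inl ⟨n, h⟩
    · exact Or.inr ⟨n, h⟩
  · have hempty : passFailure D₀ D₁ η θ Y k I = ∅ := by
      rw [Set.eq_empty_iff_forall_notMem]
      rintro ω ⟨J, hJ, hθJ⟩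
      rcases innerLoop_mem hJ with rfl | rfl
      · exact hθJ ⟨hge, hθ.2⟩
      · exact hθJ ⟨hθ.1, hle⟩
    rw [hempty, measure_empty]
    exact zero_le

/-- The interval at the start of a pass is independent of the responses in that pass. -/
lemma measure_interval_inter_passFailure (hY : IsResponseFamily μ P Y) (k : ℕ) (I : ℝ × ℝ) :
    μ ({ω | interval D₀ D₁ η (fun j i x => Y j i x ω) k = some I} ∩
        passFailure D₀ D₁ η θ Y k I) =
      μ {ω | interval D₀ D₁ η (fun j i x => Y j i x ω) k = some I} *
        μ (passFailure D₀ D₁ η θ Y k I) := by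
  let f : ℕ × ℕ × ℝ → Ω → Response := fun j => Y j.1 j.2.1 j.2.2
  have hind := indep_iSup_of_disjoint (m := fun j => MeasurableSpace.comap (f j) inferInstance)
    (fun j => (hY.measurable j.1 j.2.1 j.2.2).comap_le) hY.indep
    (S := {j | j.1 < k}) (T := {j | j.1 = k})
    (Set.disjoint_left.2 fun j (h1 : j.1 < k) (h2 : j.1 = k) => by omega)
  refine Indep_iff _ _ μ |>.1 hind _ _ ?_ ?_
  · refine measurableSet_interval_eq
      (mΩ := ⨆ j ∈ {j : ℕ × ℕ × ℝ | j.1 < k}, MeasurableSpace.comap (f j) inferInstance)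
      (fun j hj i x => ?_) I
    exact measurable_iSup_comap f (i := (j, i, x)) hj
  · refine measurableSet_passFailure
      (mΩ := ⨆ j ∈ {j : ℕ × ℕ × ℝ | j.1 = k}, MeasurableSpace.comap (f j) inferInstance)
      (fun i x => ?_) I
    exact measurable_iSup_comap f (i := (k, i, x)) rfl

lemma measure_exists_interval_passFailure_le [IsProbabilityMeasure μ] (hD₀ : IsMeanConstant D₀)
    (hD₁ : IsVarConstant D₁) (hP : LabelerCondition P θ) (hY : IsResponseFamily μ P Y) (hη : 0 < η)
    (hη1 : η ≤ 1 / 4) (k : ℕ) :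
    μ {ω | ∃ I, interval D₀ D₁ η (fun j i x => Y j i x ω) k = some I ∧ θ ∈ Set.Icc I.1 I.2 ∧
      ω ∈ passFailure D₀ D₁ η θ Y k I} ≤ ENNReal.ofReal (2 * η) := by
  classical
  set E : ℝ × ℝ → Set Ω := fun I =>
    {ω | interval D₀ D₁ η (fun j i x => Y j i x ω) k = some I} with hE
  set T := (reachable k).filter fun I => θ ∈ Set.Icc I.1 I.2 with hT
  calc _ ≤ μ (⋃ I ∈ T, E I ∩ passFailure D₀ D₁ η θ Y k I) := by
        refine measure_mono ?_
        rintro ω ⟨I, hI, hθ, hω⟩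
        exact Set.mem_biUnion (Finset.mem_filter.2 ⟨interval_mem_reachable hI, hθ⟩) ⟨hI, hω⟩
    _ ≤ ∑ I ∈ T, μ (E I ∩ passFailure D₀ D₁ η θ Y k I) := measure_biUnion_finset_le _ _
    _ ≤ ∑ I ∈ T, μ (E I) * ENNReal.ofReal (2 * η) := by
        refine Finset.sum_le_sum fun I hI => ?_
        obtain ⟨hI1, hθ⟩ := Finset.mem_filter.1 hI
        obtain ⟨h0, h1, h2⟩ := reachable_bounds hI1
        have : (0 : ℝ) < (3 / 4) ^ k := by positivity
        rw [measure_interval_inter_passFailure hY]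
        gcongr
        exact measure_passFailure_le hD₀ hD₁ hP hY hη hη1 k h0 h1 (by linarith) hθ
    _ = μ (⋃ I ∈ T, E I) * ENNReal.ofReal (2 * η) := by
        rw [← Finset.sum_mul, measure_biUnion_finset]
        · intro I _ J _ hIJ
          refine Set.disjoint_left.2 fun ω hI hJ => hIJ ?_
          exact Option.some.inj (hI.symm.trans hJ)
        · exact fun I _ => measurableSet_interval_eq (fun j _ i x => hY.measurable j i x) I
    _ ≤ ENNReal.ofReal (2 * η) := mul_le_of_le_one_left' prob_le_one

end Failure

lemma mem_interval_of_no_passFailure {Ω : Type*} {D₀ D₁ η θ : ℝ} (hθ : θ ∈ Set.Icc (0 : ℝ) 1)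
    {Y : ℕ → ℕ → ℝ → Ω → Response} {ω : Ω} {K : ℕ}
    (h : ∀ k < K, ¬ ∃ I, interval D₀ D₁ η (fun j i x => Y j i x ω) k = some I ∧
      θ ∈ Set.Icc I.1 I.2 ∧ ω ∈ passFailure D₀ D₁ η θ Y k I) {I : ℝ × ℝ}
    (hI : interval D₀ D₁ η (fun j i x => Y j i x ω) K = some I) : θ ∈ Set.Icc I.1 I.2 := by
  induction K generalizing I with
  | zero =>
    obtain rfl : (0, 1) = I := Option.some.inj hI
    exact hθ
  | succ k ih =>
    rw [interval, Option.bind_eq_some_iff] at hI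
    obtain ⟨J, hJ, hI⟩ := hI
    by_contra hθI
    exact h k (by omega) ⟨J, hJ, ih (fun j hj => h j (by omega)) hJ, I, hI, hθI⟩

end ThresholdLearning

open ThresholdLearning in
theorem mainTheorem1 :
    (∃ D₀ : ℝ, ThresholdLearning.IsMeanConstant D₀) ∧
    (∃ D₁ : ℝ, ThresholdLearning.IsVarConstant D₁) ∧
    ∀ D₀ D₁ : ℝ, ThresholdLearning.IsMeanConstant D₀ → ThresholdLearning.IsVarConstant D₁ →
      ∀ (θ : ℝ), θ ∈ Set.Icc (0 : ℝ) 1 →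
      ∀ (P : ℝ → PMF ThresholdLearning.Response), ThresholdLearning.LabelerCondition P θ →
      ∀ (δ ε : ℝ), 0 < δ → δ < 1 → 0 < ε → (∃ K : ℕ, ThresholdLearning.logInv ε = K) →
      ∀ (Ω : Type*) [MeasurableSpace Ω] (μ : Measure Ω) [IsProbabilityMeasure μ]
        (Y : ℕ → ℕ → ℝ → Ω → ThresholdLearning.Response),
        ThresholdLearning.IsResponseFamily μ P Y →
        1 - δ / 2 ≤ μ.real {ω | ∀ θhat : ℝ,
          ThresholdLearning.output D₀ D₁ δ ε (fun k i x => Y k i x ω) = some θhat →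
            |θhat - θ| ≤ ε} := by
  refine ⟨exists_isMeanConstant, exists_isVarConstant, ?_⟩
  rintro D₀ D₁ hD₀ hD₁ θ hθ P hP δ ε hδ hδ1 hε ⟨K, hK⟩ Ω _ μ _ Y hY
  set η := δ / (4 * (K : ℝ)) with hη
  set bad : ℕ → Set Ω := fun k => {ω | ∃ I, interval D₀ D₁ η (fun j i x => Y j i x ω) k = some I ∧
    θ ∈ Set.Icc I.1 I.2 ∧ ω ∈ passFailure D₀ D₁ η θ Y k I} with hbad
  have hε2 : (3 / 4 : ℝ) ^ K = 2 * ε := by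
    have h := Real.rpow_logb (show (0 : ℝ) < 4 / 3 by norm_num) (by norm_num)
      (show 0 < 1 / (2 * ε) by positivity)
    change (4 / 3 : ℝ) ^ logInv ε = _ at h
    rw [hK, Real.rpow_natCast] at h
    rw [show (3 / 4 : ℝ) = (4 / 3)⁻¹ by norm_num, inv_pow, h, one_div, inv_inv]
  have hsum : μ (⋃ k ∈ Finset.range K, bad k) ≤ ENNReal.ofReal (δ / 2) := by
    rcases Nat.eq_zero_or_pos K with rfl | hKpos
    -- without a pass no test is made, and the junk value `η = δ / 0` does not matter
    · simp
    have hK1 : (1 : ℝ) ≤ K := by exact_mod_cast hKpos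
    have hη0 : 0 < η := by positivity
    have hη1 : η ≤ 1 / 4 := by
      rw [hη, div_le_div_iff₀ (by positivity) (by norm_num)]
      linarith
    calc _ ≤ ∑ k ∈ Finset.range K, μ (bad k) := measure_biUnion_finset_le _ _
      _ ≤ ∑ k ∈ Finset.range K, ENNReal.ofReal (2 * η) := Finset.sum_le_sum fun k _ =>
          measure_exists_interval_passFailure_le hD₀ hD₁ hP hY hη0 hη1 k
      _ = ENNReal.ofReal (δ / 2) := by
          rw [← ENNReal.ofReal_sum_of_nonneg fun _ _ => by positivity]
          congr 1
          rw [Finset.sum_const, Finset.card_range, nsmul_eq_mul, hη]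
          field_simp
          norm_num
  refine one_sub_le_measureReal (by positivity) hsum
    (Filter.Eventually.of_forall fun ω hω θhat h => ?_)
  rw [output, hK, Nat.floor_natCast, Option.map_eq_some_iff] at h
  obtain ⟨I, hI, rfl⟩ := h
  have hmem := mem_interval_of_no_passFailure hθ
    (fun k hk hb => hω (Set.mem_biUnion (Finset.mem_range.2 hk) hb)) hI
  obtain ⟨_, _, hlen⟩ := reachable_bounds (interval_mem_reachable hI)
  rw [hε2] at hlen
  rw [abs_le]
  constructor <;> linarith [hmem.1, hmem.2]
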